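/- Let $X$ be a compact metric space and let $\varphi:\mathbb{R}_{\ge 0}\times X\to X$ be a semiflow, i.e. a continuous map with $\varphi(0,x)=x$ and $\varphi(s+t,x)=\varphi(s,\varphi(t,x))$ (the forward-time part of a flow is a special case). For $Y\subseteq X$ put $\omega(Y)=\bigcap_{t>0}\overline{\varphi([t,\infty),Y)}$. A set $A\subseteq X$ is an attractor if $\omega(U)=A$ for some neighbourhood $U$ of $A$; its dual repeller is $R=\{x\in X:\omega(x)\cap A=\emptyset\}$, and $(A,R)$ is then called an attractor–repeller pair. A set $S$ is invariant if $\varphi(t,S)=S$ for all $t\ge 0$, and $\mathrm{Inv}(Y)$ denotes the union of all invariant subsets of $Y$. An index pair for a set $S\subseteq X$ is a pair of compact sets $L\subseteq N\subseteq X$ such that (1) $S=\mathrm{Inv}(\overline{N\setminus L})$ and $N\setminus L$ is a neighbourhood of $S$; (2) if $x\in L$ and $\varphi([0,t],x)\subseteq N$, then $\varphi([0,t],x)\subseteq L$; (3) if $x\in N$, $t_1>0$ and $\varphi(t_1,x)\notin N$, then there is $t_0\in[0,t_1]$ with $\varphi([0,t_0],x)\subseteq N$ and $\varphi(t_0,x)\in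 L$. The index pair is called good if $H_i(N,L)\cong\tilde H_i(N/L)$ for all $i\ge 0$, where $H_\bullet$ is singular homology with integer coefficients and $N/L$ is the pointed quotient space (with $N/\emptyset$ meaning $N$ with an isolated base point added). The homological Conley index of an invariant set $S$ that admits a good index pair $(N,L)$ is $CH_\bullet(S)=H_\bullet(N,L)$. Write $CH_\bullet(X)$ and $CH_\bullet(R)$ for the Conley indices of $\mathrm{Inv}(X)$ and $\mathrm{Inv}(R)$ (which equal $X$ and $R$ if $\varphi$ is a flow). Proposition. Let $(A,R)$ be an attractor–repeller pair of $\varphi$ such that $$CH_i(A)\cong\begin{cases}\mathbb{Z}& i=0,1\\ 0& i>1\end{cases}\qquad\text{and}\qquad CH_i(X)\cong\begin{cases}\mathbb{Z}& i=0\\ 0& i>0,\end{cases}$$ where each of these two indices is computed from some good index pair. Then $\mathrm{Inv}(R)$ has a good index pair, and $$CH_i(R)\cong\begin{cases}\mathbb{Z}& i=2\\ 0& i\neq 2\end{cases}$$ for every $i\ge 0$, whichever good index pair of $\mathrm{Inv}(R)$ is used to compute it. -/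

import Mathlib

open scoped NNReal Topology

namespace ConleyIndex

open CategoryTheory CategoryTheory.Limits

universe u

noncomputable section

/-! ### Singular homology of pairs, with integer coefficients -/

/-- The singular chain complex `C_•(Y)` of a space, with integer coefficients. -/
def singularChains (Y : TopCat.{u}) : ChainComplex (ModuleCat.{u} ℤ) ℕ :=
  ((AlgebraicTopology.singularChainComplexFunctor (ModuleCat.{u} ℤ)).obj
    (ModuleCat.of ℤ (ULift.{u} ℤ))).obj Y

/-- The chain map `C_•(Y) ⟶ C_•(Z)` induced by a continuous map. -/
def singularChainsMap {Y Z : TopCat.{u}} (f : Y ⟶ Z) : singularChains Y ⟶ singularChains Z :=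
  ((AlgebraicTopology.singularChainComplexFunctor (ModuleCat.{u} ℤ)).obj
    (ModuleCat.of ℤ (ULift.{u} ℤ))).map f

/-- The inclusion of a subspace `B ⊆ Y`. -/
def subspaceIncl (Y : Type u) [TopologicalSpace Y] (B : Set Y) : TopCat.of B ⟶ TopCat.of Y :=
  TopCat.ofHom ⟨Subtype.val, continuous_subtype_val⟩

/-- The relative singular chain complex `C_•(Y) / C_•(B)` of a pair `B ⊆ Y`. -/
def relChains (Y : Type u) [TopologicalSpace Y] (B : Set Y) :
    ChainComplex (ModuleCat.{u} ℤ) ℕ :=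
  cokernel (singularChainsMap (subspaceIncl Y B))

/-- The relative singular homology group `H_i(Y, B)` with integer coefficients. -/
def relHomology (Y : Type u) [TopologicalSpace Y] (B : Set Y) (i : ℕ) : ModuleCat.{u} ℤ :=
  (relChains Y B).homology i

/-! ### Pairs of subsets of a space and their quotients -/

section Pairs

variable {X : Type u} [TopologicalSpace X]

/-- `H_i(N, L)` for subsets `L ⊆ N` of a space `X`, both with the subspace topology. -/
def pairHomology (N L : Set X) (i : ℕ) : ModuleCat.{u} ℤ :=
  relHomology N {y : N | (y : X) ∈ L} i

/-- The relation on `N ⊔ {*}` that identifies every point of `L` with `*`. -/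
def collapseRel (N L : Set X) (a b : N ⊕ PUnit.{u + 1}) : Prop :=
  ∃ y : N, (y : X) ∈ L ∧ a = Sum.inl y ∧ b = Sum.inr PUnit.unit

/-- The pointed quotient space `N / L`, in which `L` is collapsed to the base point, with the
quotient topology; if `L` is empty, it is `N` with an isolated base point added. -/
abbrev PointedQuotient (N L : Set X) : Type u := Quot (collapseRel N L)

/-- The base point `[L]` of `N / L`. -/
def basePoint (N L : Set X) : PointedQuotient N L := Quot.mk _ (Sum.inr PUnit.unit)

/-- The reduced homology of the pointed space `N / L`, as homology relative to the base point. -/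
def quotientHomology (N L : Set X) (i : ℕ) : ModuleCat.{u} ℤ :=
  relHomology (PointedQuotient N L) {basePoint N L} i

end Pairs

/-! ### Semiflows, attractor–repeller pairs, index pairs -/

section Dynamics

variable {X : Type u} [TopologicalSpace X] (φ : Flow ℝ≥0 X)

/-- `A` is an attractor: it is the `ω`-limit set of one of its neighbourhoods. -/
def IsAttractor (A : Set X) : Prop :=
  ∃ U ∈ 𝓝ˢ A, omegaLimit Filter.atTop φ U = A

/-- The dual repeller of `A`: the points whose `ω`-limit set does not meet `A`. -/
def dualRepeller (A : Set X) : Set X :=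
  {x | Disjoint (omegaLimit Filter.atTop φ {x}) A}

/-- `S` is an invariant set: `φ(t, S) = S` for all `t ≥ 0`. -/
def IsInvariantSet (S : Set X) : Prop := ∀ t : ℝ≥0, φ t '' S = S

/-- The maximal invariant set `Inv(N)` in `N`. -/
def maxInv (N : Set X) : Set X := ⋃₀ {S | S ⊆ N ∧ IsInvariantSet φ S}

/-- `(N, L)` is an index pair for `S`. -/
structure IsIndexPair (S N L : Set X) : Prop where
  isCompact_left : IsCompact N
  isCompact_right : IsCompact L
  subset : L ⊆ N
  eq_maxInv : S = maxInv φ (closure (N \ L))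
  mem_nhdsSet : N \ L ∈ 𝓝ˢ S
  /-- `L` is positively invariant in `N`. -/
  posInvariant : ∀ x ∈ L, ∀ t : ℝ≥0, (∀ s ≤ t, φ s x ∈ N) → ∀ s ≤ t, φ s x ∈ L
  /-- `L` is an exit set for `N`. -/
  exitSet : ∀ x ∈ N, ∀ t₁ : ℝ≥0, 0 < t₁ → φ t₁ x ∉ N →
    ∃ t₀ ≤ t₁, (∀ s ≤ t₀, φ s x ∈ N) ∧ φ t₀ x ∈ L

/-- `(N, L)` is an index pair for `S` whose relative homology `H_•(N, L)` is isomorphic to the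
reduced homology of `N / L`. For such pairs `H_•(N, L)` is the Conley index of `S`; for an index
pair without this property, singular homology `H_•(N, L)` can depend on the pair. -/
structure IsGoodIndexPair (S N L : Set X) : Prop extends IsIndexPair φ S N L where
  good : ∀ i : ℕ, Nonempty (pairHomology N L i ≃ₗ[ℤ] quotientHomology N L i)

end Dynamics

end

end ConleyIndex

namespace ConleyIndex

open CategoryTheory CategoryTheory.Limits

universe u

noncomputable section

/-! ### Barycentric subdivision of ordered tuples -/

/-! The attractor $A$ has a closed, positively invariant neighbourhood $B$ inside an open,
positively invariant set $U$ with $\varphi(T,U)\subseteq B$ and $\omega(U)\subseteq A$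
(`IsAttractor.exists_block`). Then $(X,\emptyset)$, $(B,\emptyset)$ and $(X,B)$ are index pairs for
$\mathrm{Inv}(X)$, $A$ and $\mathrm{Inv}(R)$. They are good (`IsIndexPair.isGoodIndexPair`): the
semiflow pushes $U$ into $B$, both in $X$ and in $X/B$, and excision identifies $H_\bullet(X,U)$
with $H_\bullet(X/B,U/B)$.

The hypotheses concern arbitrary good pairs, and so does the conclusion, so independence of the pair
is needed (`IsGoodIndexPair.nonempty_pairHomology_equiv`). For two index pairs of the same set,
flowing for time $3T$ defines maps between $N/L$ and $N'/L'$ once $T$ is large. Their composites are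
time-$6T$ maps of the induced semiflows on the quotients, hence homotopic to the identity. Goodness
transfers this from the quotients to the pairs. That a suitable $T$ exists is a compactness
statement (`exists_squeeze`): the midpoint of a long orbit segment in $\overline{N\setminus L}$ is
close to the isolated invariant set.

Thus $B$ has the homology of a circle, $X$ that of a point, and $CH_\bullet(R)\cong H_\bullet(X,B)$.
In the long exact sequence (`relHomology_of_circle_of_point`), $H_0(B)\to H_0(X)$ is bijective
because both groups are infinite cyclic, so $H_0(X,B)=H_1(X,B)=0$. Moreover $H_2(X,B)\cong
H_1(B)\cong\mathbb{Z}$, and the higher groups vanish.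

Excision (`quasiIso_excision`) rests on barycentric subdivision, carried out on formal tuples of
points of a simplex and then transported to singular chains. -/

/-- Formal integral combinations of `k`-tuples in `P`. -/
abbrev TupleChain (P : Type*) (k : ℕ) : Type _ := (Fin k → P) →₀ ℤ

namespace TupleChain

variable {P Q : Type*}

/-- The alternating sum of the faces of a tuple. -/
def face (k : ℕ) : TupleChain P (k + 1) →ₗ[ℤ] TupleChain P k :=
  Finsupp.lift (TupleChain P k) ℤ (Fin (k + 1) → P)
    fun v => ∑ i : Fin (k + 1), (-1 : ℤ) ^ (i : ℕ) • Finsupp.single (v ∘ i.succAbove) (1 : ℤ)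

/-- The cone with apex `b`. -/
def cone (b : P) (k : ℕ) : TupleChain P k →ₗ[ℤ] TupleChain P (k + 1) :=
  Finsupp.lmapDomain ℤ ℤ fun v => (Fin.cons b v : Fin (k + 1) → P)

@[simp] lemma face_single {k : ℕ} (v : Fin (k + 1) → P) :
    face k (Finsupp.single v 1) =
      ∑ i : Fin (k + 1), (-1 : ℤ) ^ (i : ℕ) • Finsupp.single (v ∘ i.succAbove) (1 : ℤ) := by
  simp [face]

@[simp] lemma cone_single {k : ℕ} (b : P) (v : Fin k → P) (n : ℤ) :
    cone b k (Finsupp.single v n) = Finsupp.single (Fin.cons b v : Fin (k + 1) → P) n := by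
  simp [cone]

lemma hom_ext {k : ℕ} {M : Type*} [AddCommGroup M] {f g : TupleChain P k →ₗ[ℤ] M}
    (h : ∀ v, f (Finsupp.single v 1) = g (Finsupp.single v 1)) : f = g := by
  refine Finsupp.lhom_ext' fun v => LinearMap.ext_ring ?_
  simpa using h v

/-- The index counts entries, not dimension: degree zero consists of multiples of the empty tuple
and plays the role of an augmentation. -/
lemma face_cone_zero (b : P) (c : TupleChain P 0) : face 0 (cone b 0 c) = c := by
  refine LinearMap.congr_fun (f := face 0 ∘ₗ cone b 0) (g := LinearMap.id) (hom_ext fun v => ?_) c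
  simp only [LinearMap.comp_apply, cone_single, face_single, LinearMap.id_apply]
  simp [Subsingleton.elim _ v]

/-- Deleting the apex returns the tuple. Deleting any other entry commutes with coning and shifts
the index by one, hence the minus sign. -/
lemma face_cone_succ (b : P) {k : ℕ} (c : TupleChain P (k + 1)) :
    face (k + 1) (cone b (k + 1) c) = c - cone b k (face k c) := by
  refine LinearMap.congr_fun (f := face (k + 1) ∘ₗ cone b (k + 1))
    (g := LinearMap.id - cone b k ∘ₗ face k) (hom_ext fun v => ?_) c
  simp only [LinearMap.comp_apply, cone_single, face_single, LinearMap.id_apply,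
    LinearMap.sub_apply, map_sum, map_zsmul]
  rw [Fin.sum_univ_succ, sub_eq_add_neg, ← Finset.sum_neg_distrib]
  congr 1
  · simp only [Fin.val_zero, pow_zero, one_smul]
    congr 1
  · refine Finset.sum_congr rfl fun i _ => ?_
    rw [Fin.val_succ, pow_succ, mul_neg_one, neg_smul]
    congr 3
    funext j
    refine Fin.cases ?_ (fun j => ?_) j <;> simp

/-- Every nonempty tuple is the cone from its first entry over its tail, so the cone formula reduces
the claim to tuples that are one entry shorter. -/
lemma face_face {k : ℕ} (c : TupleChain P (k + 2)) : face k (face (k + 1) c) = 0 := by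
  refine LinearMap.congr_fun (f := face k ∘ₗ face (k + 1)) (g := 0) (hom_ext fun v => ?_) c
  induction k with
  | zero =>
    obtain ⟨b, w, rfl⟩ : ∃ b w, v = Fin.cons b w := ⟨v 0, Fin.tail v, by simp⟩
    rw [LinearMap.comp_apply, ← cone_single, face_cone_succ, map_sub, face_cone_zero, sub_self]
    rfl
  | succ k ih =>
    obtain ⟨b, w, rfl⟩ : ∃ b w, v = Fin.cons b w := ⟨v 0, Fin.tail v, by simp⟩
    rw [LinearMap.comp_apply, ← cone_single, face_cone_succ, map_sub, face_cone_succ,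
      show face k (face (k + 1) (Finsupp.single w 1)) = 0 from ih 0 w]
    simp

/-- The map on chains induced by a map of sets. -/
def map (g : P → Q) (k : ℕ) : TupleChain P k →ₗ[ℤ] TupleChain Q k :=
  Finsupp.lmapDomain ℤ ℤ fun v => g ∘ v

@[simp] lemma map_single (g : P → Q) {k : ℕ} (v : Fin k → P) (n : ℤ) :
    map g k (Finsupp.single v n) = Finsupp.single (g ∘ v) n := by
  simp [map]

lemma map_face (g : P → Q) {k : ℕ} (c : TupleChain P (k + 1)) :
    map g k (face k c) = face k (map g (k + 1) c) := by
  refine LinearMap.congr_fun (f := map g k ∘ₗ face k) (g := face k ∘ₗ map g (k + 1))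
    (hom_ext fun v => ?_) c
  simp [Function.comp_assoc]

lemma map_cone (g : P → Q) {k : ℕ} (b : P) (c : TupleChain P k) :
    map g (k + 1) (cone b k c) = cone (g b) k (map g k c) := by
  refine LinearMap.congr_fun (f := map g (k + 1) ∘ₗ cone b k) (g := cone (g b) k ∘ₗ map g k)
    (hom_ext fun v => ?_) c
  simp only [LinearMap.comp_apply, cone_single, map_single]
  congr 1
  funext j
  refine Fin.cases ?_ (fun j => ?_) j <;> simp

variable (bary : ∀ k : ℕ, (Fin (k + 1) → P) → P)

/-- The subdivision operator attached to a choice of a point `bary k v` for each tuple `v`. -/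
def sd : ∀ k : ℕ, TupleChain P k →ₗ[ℤ] TupleChain P k
  | 0 => LinearMap.id
  | k + 1 => Finsupp.lift (TupleChain P (k + 1)) ℤ (Fin (k + 1) → P)
      fun v => cone (bary k v) k (sd k (face k (Finsupp.single v 1)))

/-- The chain homotopy between subdivision and the identity. -/
def sdHomotopy : ∀ k : ℕ, TupleChain P k →ₗ[ℤ] TupleChain P (k + 1)
  | 0 => 0
  | k + 1 => Finsupp.lift (TupleChain P (k + 2)) ℤ (Fin (k + 1) → P)
      fun v => cone (bary k v) (k + 1)
        (Finsupp.single v 1 - sdHomotopy k (face k (Finsupp.single v 1)))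

lemma sd_zero (c : TupleChain P 0) : sd bary 0 c = c := rfl

lemma sd_succ_single {k : ℕ} (v : Fin (k + 1) → P) :
    sd bary (k + 1) (Finsupp.single v 1) =
      cone (bary k v) k (sd bary k (face k (Finsupp.single v 1))) := by
  simp [sd]

lemma sdHomotopy_zero (c : TupleChain P 0) : sdHomotopy bary 0 c = 0 := rfl

lemma sdHomotopy_succ_single {k : ℕ} (v : Fin (k + 1) → P) :
    sdHomotopy bary (k + 1) (Finsupp.single v 1) =
      cone (bary k v) (k + 1)
        (Finsupp.single v 1 - sdHomotopy bary k (face k (Finsupp.single v 1))) := by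
  simp only [sdHomotopy, Finsupp.lift_apply]
  rw [Finsupp.sum_single_index (by simp), one_smul]

/-- By induction the subdivided boundary of a tuple is a cycle, so in the cone formula only the base
of the cone survives. -/
lemma face_sd {k : ℕ} (c : TupleChain P (k + 1)) :
    face k (sd bary (k + 1) c) = sd bary k (face k c) := by
  refine LinearMap.congr_fun (f := face k ∘ₗ sd bary (k + 1)) (g := sd bary k ∘ₗ face k)
    (hom_ext fun v => ?_) c
  induction k with
  | zero => simp only [LinearMap.comp_apply, sd_succ_single, face_cone_zero]
  | succ k ih =>
    have ih' : ∀ c : TupleChain P (k + 1), face k (sd bary (k + 1) c) = sd bary k (face k c) :=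
      LinearMap.congr_fun (f := face k ∘ₗ sd bary (k + 1)) (g := sd bary k ∘ₗ face k)
        (hom_ext (ih 0))
    rw [LinearMap.comp_apply, LinearMap.comp_apply, sd_succ_single, face_cone_succ, ih', face_face]
    simp

/-- By induction $v-T\partial v$ has boundary $\mathrm{sd}\,\partial v$, where $T$ is the homotopy.
Coning from the chosen point therefore yields $v-T\partial v-\mathrm{sd}\,v$ as the boundary of
$Tv$. -/
lemma face_sdHomotopy {k : ℕ} (c : TupleChain P (k + 1)) :
    face (k + 1) (sdHomotopy bary (k + 1) c) + sdHomotopy bary k (face k c) =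
      c - sd bary (k + 1) c := by
  refine LinearMap.congr_fun
    (f := face (k + 1) ∘ₗ sdHomotopy bary (k + 1) + sdHomotopy bary k ∘ₗ face k)
    (g := LinearMap.id - sd bary (k + 1)) (hom_ext fun v => ?_) c
  induction k with
  | zero =>
    simp only [LinearMap.add_apply, LinearMap.comp_apply, LinearMap.sub_apply, LinearMap.id_apply]
    rw [sdHomotopy_succ_single, face_cone_succ, sd_succ_single, sdHomotopy_zero, sd_zero]
    simp
  | succ k ih =>
    have ih' : ∀ c : TupleChain P (k + 1),
        face (k + 1) (sdHomotopy bary (k + 1) c) = c - sd bary (k + 1) c -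
          sdHomotopy bary k (face k c) := fun c =>
      eq_sub_of_add_eq (LinearMap.congr_fun
        (f := face (k + 1) ∘ₗ sdHomotopy bary (k + 1) + sdHomotopy bary k ∘ₗ face k)
        (g := LinearMap.id - sd bary (k + 1)) (hom_ext (ih 0)) c)
    simp only [LinearMap.add_apply, LinearMap.comp_apply, LinearMap.sub_apply, LinearMap.id_apply]
    rw [sdHomotopy_succ_single, face_cone_succ, sd_succ_single, map_sub, ih', face_face]
    simp only [map_sub, map_zero, sub_zero]
    abel

variable (bary' : ∀ k : ℕ, (Fin (k + 1) → Q) → Q) (g : P → Q)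
  (hg : ∀ k v, g (bary k v) = bary' k (g ∘ v))

include hg

lemma map_sd {k : ℕ} (c : TupleChain P k) :
    map g k (sd bary k c) = sd bary' k (map g k c) := by
  refine LinearMap.congr_fun (f := map g k ∘ₗ sd bary k) (g := sd bary' k ∘ₗ map g k)
    (hom_ext fun v => ?_) c
  induction k with
  | zero => rfl
  | succ k ih =>
    have ih' : ∀ c : TupleChain P k, map g k (sd bary k c) = sd bary' k (map g k c) :=
      LinearMap.congr_fun (f := map g k ∘ₗ sd bary k) (g := sd bary' k ∘ₗ map g k)
        (hom_ext (ih 0))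
    rw [LinearMap.comp_apply, LinearMap.comp_apply, map_single, sd_succ_single, sd_succ_single,
      map_cone, hg, ← map_single, ← map_face, ih']

lemma map_sdHomotopy {k : ℕ} (c : TupleChain P k) :
    map g (k + 1) (sdHomotopy bary k c) = sdHomotopy bary' k (map g k c) := by
  refine LinearMap.congr_fun (f := map g (k + 1) ∘ₗ sdHomotopy bary k)
    (g := sdHomotopy bary' k ∘ₗ map g k) (hom_ext fun v => ?_) c
  induction k with
  | zero => simp [sdHomotopy]
  | succ k ih =>
    have ih' : ∀ c : TupleChain P k,
        map g (k + 1) (sdHomotopy bary k c) = sdHomotopy bary' k (map g k c) :=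
      LinearMap.congr_fun (f := map g (k + 1) ∘ₗ sdHomotopy bary k)
        (g := sdHomotopy bary' k ∘ₗ map g k)
        (hom_ext (ih 0))
    rw [LinearMap.comp_apply, LinearMap.comp_apply, map_single, sdHomotopy_succ_single,
      sdHomotopy_succ_single, map_cone, hg, ← map_single, ← map_face, map_sub, ih']

end TupleChain

/-! ### Affine simplices in the standard simplices -/

/-- The standard topological simplex of dimension `n`. -/
abbrev TopSimplex (n : ℕ) : Type := stdSimplex ℝ (Fin (n + 1))

/-- The vertices of the standard simplex. -/
def vertices (n : ℕ) : Fin (n + 1) → TopSimplex n := fun i => stdSimplex.vertex i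

/-- The affine map between standard simplices with prescribed values at the vertices. -/
def affineMap {n m : ℕ} (v : Fin (n + 1) → TopSimplex m) : C(TopSimplex n, TopSimplex m) where
  toFun t := ⟨fun j => ∑ i, t.1 i * (v i).1 j,
    fun j => Finset.sum_nonneg fun i _ => mul_nonneg (t.2.1 i) ((v i).2.1 j), by
      rw [Finset.sum_comm]
      simp only [← Finset.mul_sum, (v _).2.2, mul_one, t.2.2]⟩
  continuous_toFun := by
    refine Continuous.subtype_mk (continuous_pi fun j => ?_) _
    exact continuous_finsetSum _ fun i _ =>
      ((continuous_apply i).comp continuous_subtype_val).mul continuous_const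

lemma affineMap_val {n m : ℕ} (v : Fin (n + 1) → TopSimplex m) (t : TopSimplex n) :
    (affineMap v t).1 = ∑ i, t.1 i • (v i).1 := by
  funext j
  simp [affineMap]

lemma affineMap_vertices_apply {n m : ℕ} (v : Fin (n + 1) → TopSimplex m) (i : Fin (n + 1)) :
    affineMap v (vertices n i) = v i := by
  refine Subtype.ext ?_
  rw [affineMap_val]
  simp [vertices, Pi.single_apply]

@[simp] lemma affineMap_comp_vertices {n m : ℕ} (v : Fin (n + 1) → TopSimplex m) :
    affineMap v ∘ vertices n = v :=
  funext (affineMap_vertices_apply v)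

lemma affineMap_comp {n m l : ℕ} (w : Fin (m + 1) → TopSimplex l) (v : Fin (n + 1) → TopSimplex m) :
    (affineMap w).comp (affineMap v) = affineMap (affineMap w ∘ v) := by
  ext t : 1
  refine Subtype.ext (funext fun j => ?_)
  simp only [ContinuousMap.comp_apply, affineMap, ContinuousMap.coe_mk, Function.comp_apply,
    Finset.sum_mul, Finset.mul_sum, mul_assoc]
  exact Finset.sum_comm

@[simp] lemma affineMap_vertices (n : ℕ) : affineMap (vertices n) = ContinuousMap.id _ := by
  ext t : 1
  refine Subtype.ext (funext fun j => ?_)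
  simp [affineMap, vertices, Pi.single_apply]

/-- The barycenter of a tuple of points of a standard simplex. -/
def baryPoint (m k : ℕ) (v : Fin (k + 1) → TopSimplex m) : TopSimplex m :=
  affineMap v stdSimplex.barycenter

lemma affineMap_baryPoint {m l k : ℕ} (w : Fin (m + 1) → TopSimplex l)
    (v : Fin (k + 1) → TopSimplex m) :
    affineMap w (baryPoint m k v) = baryPoint l k (affineMap w ∘ v) := by
  rw [baryPoint, baryPoint, ← affineMap_comp]
  rfl

lemma dist_affineMap_le {n m : ℕ} (v : Fin (n + 1) → TopSimplex m) (t : TopSimplex n)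
    (x : TopSimplex m) {r : ℝ} (h : ∀ i, dist (v i) x ≤ r) : dist (affineMap v t) x ≤ r := by
  have hmem : (affineMap v t).1 ∈ Metric.closedBall x.1 r := by
    rw [affineMap_val]
    exact (convex_closedBall x.1 r).sum_mem (fun i _ => t.2.1 i) t.2.2 fun i _ => h i
  exact hmem

lemma dist_baryPoint_le {m k : ℕ} (v : Fin (k + 1) → TopSimplex m) {D : ℝ}
    (h : ∀ i j, dist (v i) (v j) ≤ D) (j : Fin (k + 1)) :
    dist (baryPoint m k v) (v j) ≤ k / (k + 1) * D := by
  have hk : (0 : ℝ) < k + 1 := by positivity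
  have hval : (baryPoint m k v).1 - (v j).1 = ∑ i, ((k : ℝ) + 1)⁻¹ • ((v i).1 - (v j).1) := by
    rw [baryPoint, affineMap_val]
    simp only [smul_sub, Finset.sum_sub_distrib, Finset.sum_const, stdSimplex.barycenter_apply]
    simp only [Fintype.card_fin, Finset.card_univ, ← Nat.cast_smul_eq_nsmul ℝ, smul_smul]
    push_cast
    rw [mul_inv_cancel₀ hk.ne', one_smul]
  rw [Subtype.dist_eq, dist_eq_norm, hval]
  refine (norm_sum_le _ _).trans ?_
  -- The summand `i = j` vanishes. That leaves `k` summands with weight `1 / (k + 1)`, which is the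
  -- source of the contraction factor.
  rw [← Finset.sum_erase _ (a := j) (by simp)]
  refine (Finset.sum_le_card_nsmul _ _ (((k : ℝ) + 1)⁻¹ * D) fun i _ => ?_).trans ?_
  · rw [norm_smul, Real.norm_of_nonneg (by positivity), ← dist_eq_norm]
    exact mul_le_mul_of_nonneg_left (h i j) (by positivity)
  · rw [Finset.card_erase_of_mem (Finset.mem_univ j)]
    simp only [Finset.card_univ, Fintype.card_fin, Nat.add_sub_cancel, nsmul_eq_mul]
    apply le_of_eq
    ring

/-- Tuples of diameter at most `D` contained in every closed ball that contains `v`. -/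
def smallTuples {m l : ℕ} (v : Fin l → TopSimplex m) (k : ℕ) (D : ℝ) : Set (Fin k → TopSimplex m) :=
  {w | (∀ i j, dist (w i) (w j) ≤ D) ∧
    ∀ x r, (∀ i, dist (v i) x ≤ r) → ∀ j, dist (w j) x ≤ r}

/-- The ball condition in `smallTuples` carries the induction. The vertices of `v` lie in the closed
ball of radius `k / (k + 1) * D` about the barycenter, hence so do the vertices of the subdivided
faces; this bounds the edges at the new apex. The other edges are bounded by induction, since `k /
(k + 1)` increases with `k`. -/
lemma sd_mem_supported_smallTuples {m : ℕ} (k : ℕ) (v : Fin (k + 1) → TopSimplex m) {D : ℝ}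
    (h : ∀ i j, dist (v i) (v j) ≤ D) :
    TupleChain.sd (baryPoint m) (k + 1) (Finsupp.single v 1) ∈
      Finsupp.supported ℤ ℤ (smallTuples v (k + 1) (k / (k + 1) * D)) := by
  have hD : 0 ≤ D := dist_nonneg.trans (h 0 0)
  induction k with
  | zero =>
    rw [TupleChain.sd_succ_single, TupleChain.sd_zero]
    have : TupleChain.face 0 (Finsupp.single v 1) = Finsupp.single Fin.elim0 1 := by
      simp [Subsingleton.elim _ (Fin.elim0 : Fin 0 → TopSimplex m)]
    rw [this, TupleChain.cone_single]
    refine Finsupp.single_mem_supported ℤ _ ⟨fun i j => ?_, fun x r hv j => ?_⟩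
    · obtain rfl : i = j := by omega
      simp
    · obtain rfl : j = 0 := by omega
      rw [Fin.cons_zero]
      exact dist_affineMap_le _ _ _ hv
  | succ k ih =>
    rw [TupleChain.sd_succ_single, TupleChain.face_single, map_sum, map_sum]
    refine Submodule.sum_mem _ fun i _ => ?_
    rw [map_zsmul, map_zsmul]
    refine Submodule.smul_mem _ _ ?_
    have hi := ih (v ∘ i.succAbove) fun a b => h _ _
    set c := TupleChain.sd (baryPoint m) (k + 1) (Finsupp.single (v ∘ i.succAbove) 1)
    have hle : (k : ℝ) / (k + 1) * D ≤ ((k + 1 : ℕ) : ℝ) / ((k + 1 : ℕ) + 1) * D := by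
      refine mul_le_mul_of_nonneg_right ?_ hD
      rw [div_le_div_iff₀ (by positivity) (by positivity)]
      push_cast
      nlinarith
    rw [Finsupp.supported_eq_span_single] at hi ⊢
    refine Submodule.span_induction (p := fun c _ => TupleChain.cone (baryPoint m (k + 1) v) (k + 1) c ∈
      Submodule.span ℤ _) ?_ ?_ ?_ ?_ hi
    · rintro _ ⟨w, hw, rfl⟩
      have hball : ∀ x r, (∀ i, dist (v i) x ≤ r) → ∀ j, dist (w j) x ≤ r :=
        fun x r hv => hw.2 x r fun i => hv _
      have hb : ∀ j, dist (w j) (baryPoint m (k + 1) v) ≤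
          ((k + 1 : ℕ) : ℝ) / ((k + 1 : ℕ) + 1) * D := hball _ _ fun i => by
        rw [dist_comm]; exact dist_baryPoint_le v h i
      simp only [TupleChain.cone_single]
      refine Submodule.subset_span ⟨_, ⟨fun a b => ?_, fun x r hv a => ?_⟩, rfl⟩
      · refine Fin.cases ?_ (fun a => ?_) a <;> refine Fin.cases ?_ (fun b => ?_) b
        · simp only [dist_self]; positivity
        · rw [Fin.cons_zero, Fin.cons_succ, dist_comm]; exact hb b
        · rw [Fin.cons_zero, Fin.cons_succ]; exact hb a
        · rw [Fin.cons_succ, Fin.cons_succ]; exact (hw.1 a b).trans hle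
      · refine Fin.cases ?_ (fun a => ?_) a
        · rw [Fin.cons_zero]; exact dist_affineMap_le _ _ _ hv
        · rw [Fin.cons_succ]; exact hball x r hv a
    · rw [map_zero]; exact Submodule.zero_mem _
    · intro a b _ _ ha hb; rw [map_add]; exact Submodule.add_mem _ ha hb
    · intro n a _ ha; rw [map_zsmul]; exact Submodule.smul_mem _ _ ha

/-- Tuples of diameter at most `D`. -/
def tuplesOfDiam (m k : ℕ) (D : ℝ) : Set (Fin k → TopSimplex m) :=
  {w | ∀ i j, dist (w i) (w j) ≤ D}

lemma sd_mem_supported_tuplesOfDiam {m k : ℕ} {D : ℝ} {c : TupleChain (TopSimplex m) (k + 1)}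
    (hc : c ∈ Finsupp.supported ℤ ℤ (tuplesOfDiam m (k + 1) D)) :
    TupleChain.sd (baryPoint m) (k + 1) c ∈
      Finsupp.supported ℤ ℤ (tuplesOfDiam m (k + 1) (k / (k + 1) * D)) := by
  rw [Finsupp.supported_eq_span_single] at hc
  refine Submodule.span_induction (p := fun c _ => TupleChain.sd (baryPoint m) (k + 1) c ∈
      Finsupp.supported ℤ ℤ _) ?_ ?_ ?_ ?_ hc
  · rintro _ ⟨w, hw, rfl⟩
    exact Finsupp.supported_mono (fun _ h => h.1) (sd_mem_supported_smallTuples k w hw)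
  · rw [map_zero]; exact Submodule.zero_mem _
  · intro a b _ _ ha hb; rw [map_add]; exact Submodule.add_mem _ ha hb
  · intro n a _ ha; rw [map_zsmul]; exact Submodule.smul_mem _ _ ha

lemma sd_iterate_mem_supported_tuplesOfDiam (n N : ℕ) :
    (TupleChain.sd (baryPoint n) (n + 1))^[N] (Finsupp.single (vertices n) 1) ∈
      Finsupp.supported ℤ ℤ (tuplesOfDiam n (n + 1) ((n / (n + 1) : ℝ) ^ N)) := by
  induction N with
  | zero =>
    refine Finsupp.single_mem_supported ℤ _ fun i j => ?_
    rw [pow_zero]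
    exact (Metric.dist_le_diam_of_mem (bounded_stdSimplex _) (vertices n i).2
      (vertices n j).2).trans diam_stdSimplex_le
  | succ N ih =>
    rw [Function.iterate_succ_apply', pow_succ']
    exact sd_mem_supported_tuplesOfDiam ih

/-! ### Subdivision of singular chains -/

/-- Integral combinations of singular simplices, as finitely supported functions. -/
abbrev SingChain (Y : Type*) [TopologicalSpace Y] (n : ℕ) : Type _ := C(TopSimplex n, Y) →₀ ℤ

namespace SingChain

variable {Y Z : Type*} [TopologicalSpace Y] [TopologicalSpace Z]

lemma hom_ext {n : ℕ} {M : Type*} [AddCommGroup M] [Module ℤ M]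
    {f g : SingChain Y n →ₗ[ℤ] M}
    (h : ∀ σ, f (Finsupp.single σ 1) = g (Finsupp.single σ 1)) : f = g := by
  refine Finsupp.lhom_ext' fun v => LinearMap.ext_ring ?_
  simpa using h v

/-- The linear map on singular chains with prescribed values on simplices. -/
def lift {n : ℕ} {M : Type*} [AddCommGroup M] [Module ℤ M] (f : C(TopSimplex n, Y) → M) :
    SingChain Y n →ₗ[ℤ] M :=
  Finsupp.lsum ℕ fun σ => LinearMap.toSpanSingleton ℤ M (f σ)

@[simp] lemma lift_single {n : ℕ} {M : Type*} [AddCommGroup M] [Module ℤ M]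
    (f : C(TopSimplex n, Y) → M)
    (σ : C(TopSimplex n, Y)) : lift f (Finsupp.single σ 1) = f σ := by
  rw [lift, Finsupp.lsum_single, LinearMap.toSpanSingleton_apply]
  exact @one_smul ℤ M _ (Module.toDistribMulAction.toMulAction) (f σ)

/-- The singular chain obtained from a chain of tuples in the source of a singular simplex. -/
def realize {n : ℕ} (σ : C(TopSimplex n, Y)) (k : ℕ) :
    TupleChain (TopSimplex n) (k + 1) →ₗ[ℤ] SingChain Y k :=
  Finsupp.lmapDomain ℤ ℤ fun v => σ.comp (affineMap v)

@[simp] lemma realize_single {n : ℕ} (σ : C(TopSimplex n, Y)) {k : ℕ}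
    (v : Fin (k + 1) → TopSimplex n) (a : ℤ) :
    realize σ k (Finsupp.single v a) = Finsupp.single (σ.comp (affineMap v)) a := by
  simp [realize]

/-- The boundary operator on singular chains. -/
def boundary (n : ℕ) : SingChain Y (n + 1) →ₗ[ℤ] SingChain Y n :=
  lift fun σ => realize σ n (TupleChain.face (n + 1) (Finsupp.single (vertices (n + 1)) 1))

/-- The map on singular chains induced by a continuous map. -/
def map (f : C(Y, Z)) (n : ℕ) : SingChain Y n →ₗ[ℤ] SingChain Z n :=
  Finsupp.lmapDomain ℤ ℤ fun σ => f.comp σ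

@[simp] lemma map_single (f : C(Y, Z)) {n : ℕ} (σ : C(TopSimplex n, Y)) (a : ℤ) :
    map f n (Finsupp.single σ a) = Finsupp.single (f.comp σ) a := by
  simp [map]

lemma map_realize (f : C(Y, Z)) {n k : ℕ} (σ : C(TopSimplex n, Y))
    (c : TupleChain (TopSimplex n) (k + 1)) :
    map f k (realize σ k c) = realize (f.comp σ) k c := by
  refine LinearMap.congr_fun (f := map f k ∘ₗ realize σ k) (g := realize (f.comp σ) k)
    (TupleChain.hom_ext fun v => ?_) c
  simp [ContinuousMap.comp_assoc]

lemma realize_comp_affineMap {n m k : ℕ} (σ : C(TopSimplex m, Y)) (v : Fin (n + 1) → TopSimplex m)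
    (c : TupleChain (TopSimplex n) (k + 1)) :
    realize (σ.comp (affineMap v)) k c = realize σ k (TupleChain.map (affineMap v) (k + 1) c) := by
  refine LinearMap.congr_fun (f := realize (σ.comp (affineMap v)) k)
    (g := realize σ k ∘ₗ TupleChain.map (affineMap v) (k + 1)) (TupleChain.hom_ext fun w => ?_) c
  simp [ContinuousMap.comp_assoc, affineMap_comp]

/-- Operators on singular chains are defined on the tuple of vertices of the standard simplex. Any
tuple is the affine image of that one, so naturality of the tuple operator under affine maps gives
compatibility with `realize`. The subdivision and its homotopy are treated in the same way. -/
lemma realize_face {n k : ℕ} (σ : C(TopSimplex n, Y)) (c : TupleChain (TopSimplex n) (k + 2)) :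
    realize σ k (TupleChain.face (k + 1) c) = boundary k (realize σ (k + 1) c) := by
  refine LinearMap.congr_fun (f := realize σ k ∘ₗ TupleChain.face (k + 1))
    (g := boundary k ∘ₗ realize σ (k + 1)) (TupleChain.hom_ext fun w => ?_) c
  rw [LinearMap.comp_apply, LinearMap.comp_apply, realize_single, boundary, lift_single,
    realize_comp_affineMap, TupleChain.map_face, TupleChain.map_single, affineMap_comp_vertices]

lemma realize_vertices {n : ℕ} (σ : C(TopSimplex n, Y)) (a : ℤ) :
    realize σ n (Finsupp.single (vertices n) a) = Finsupp.single σ a := by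
  simp

/-- Barycentric subdivision of singular chains. -/
def sd (n : ℕ) : SingChain Y n →ₗ[ℤ] SingChain Y n :=
  lift fun σ => realize σ n
    (TupleChain.sd (baryPoint n) (n + 1) (Finsupp.single (vertices n) 1))

/-- The chain homotopy between barycentric subdivision and the identity. -/
def sdHomotopy (n : ℕ) : SingChain Y n →ₗ[ℤ] SingChain Y (n + 1) :=
  lift fun σ => realize σ (n + 1)
    (TupleChain.sdHomotopy (baryPoint n) (n + 1) (Finsupp.single (vertices n) 1))

lemma realize_sd {n k : ℕ} (σ : C(TopSimplex n, Y)) (c : TupleChain (TopSimplex n) (k + 1)) :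
    realize σ k (TupleChain.sd (baryPoint n) (k + 1) c) = sd k (realize σ k c) := by
  refine LinearMap.congr_fun (f := realize σ k ∘ₗ TupleChain.sd (baryPoint n) (k + 1))
    (g := sd k ∘ₗ realize σ k) (TupleChain.hom_ext fun w => ?_) c
  rw [LinearMap.comp_apply, LinearMap.comp_apply, realize_single, sd, lift_single,
    realize_comp_affineMap, TupleChain.map_sd _ _ _ fun k v => affineMap_baryPoint w v,
    TupleChain.map_single, affineMap_comp_vertices]

lemma realize_sdHomotopy {n k : ℕ} (σ : C(TopSimplex n, Y))
    (c : TupleChain (TopSimplex n) (k + 1)) :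
    realize σ (k + 1) (TupleChain.sdHomotopy (baryPoint n) (k + 1) c) =
      sdHomotopy k (realize σ k c) := by
  refine LinearMap.congr_fun (f := realize σ (k + 1) ∘ₗ TupleChain.sdHomotopy (baryPoint n) (k + 1))
    (g := sdHomotopy k ∘ₗ realize σ k) (TupleChain.hom_ext fun w => ?_) c
  rw [LinearMap.comp_apply, LinearMap.comp_apply, realize_single, sdHomotopy, lift_single,
    realize_comp_affineMap, TupleChain.map_sdHomotopy _ _ _ fun k v => affineMap_baryPoint w v,
    TupleChain.map_single, affineMap_comp_vertices]

lemma boundary_sd {n : ℕ} (c : SingChain Y (n + 1)) :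
    boundary n (sd (n + 1) c) = sd n (boundary n c) := by
  refine LinearMap.congr_fun (f := boundary n ∘ₗ sd (n + 1)) (g := sd n ∘ₗ boundary n)
    (hom_ext fun σ => ?_) c
  rw [LinearMap.comp_apply, LinearMap.comp_apply, sd, lift_single, ← realize_face,
    TupleChain.face_sd, realize_sd, boundary, lift_single]

lemma boundary_sdHomotopy_zero (c : SingChain Y 0) :
    boundary 0 (sdHomotopy 0 c) = c - sd 0 c := by
  refine LinearMap.congr_fun (f := boundary 0 ∘ₗ sdHomotopy 0) (g := LinearMap.id - sd 0)
    (hom_ext fun σ => ?_) c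
  rw [LinearMap.comp_apply, LinearMap.sub_apply, LinearMap.id_apply, sdHomotopy, sd, lift_single,
    lift_single, ← realize_face]
  have h := TupleChain.face_sdHomotopy (baryPoint 0) (Finsupp.single (vertices 0) 1)
  rw [TupleChain.sdHomotopy_zero, add_zero] at h
  rw [h, map_sub, realize_vertices]

lemma boundary_sdHomotopy {n : ℕ} (c : SingChain Y (n + 1)) :
    boundary (n + 1) (sdHomotopy (n + 1) c) + sdHomotopy n (boundary n c) = c - sd (n + 1) c := by
  refine LinearMap.congr_fun
    (f := boundary (n + 1) ∘ₗ sdHomotopy (n + 1) + sdHomotopy n ∘ₗ boundary n)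
    (g := LinearMap.id - sd (n + 1)) (hom_ext fun σ => ?_) c
  simp only [LinearMap.add_apply, LinearMap.comp_apply, LinearMap.sub_apply, LinearMap.id_apply]
  have h₁ : boundary n (Finsupp.single σ 1) =
      realize σ n (TupleChain.face (n + 1) (Finsupp.single (vertices (n + 1)) 1)) := lift_single _ _
  have h₂ : sdHomotopy (n + 1) (Finsupp.single σ 1) = realize σ (n + 2)
      (TupleChain.sdHomotopy (baryPoint (n + 1)) (n + 2) (Finsupp.single (vertices (n + 1)) 1)) :=
    lift_single _ _
  have h₃ : sd (n + 1) (Finsupp.single σ 1) = realize σ (n + 1)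
      (TupleChain.sd (baryPoint (n + 1)) (n + 2) (Finsupp.single (vertices (n + 1)) 1)) :=
    lift_single _ _
  rw [h₁, h₂, h₃, ← realize_face, ← realize_sdHomotopy, ← map_add, TupleChain.face_sdHomotopy,
    map_sub, realize_vertices]

lemma map_sd (f : C(Y, Z)) {n : ℕ} (c : SingChain Y n) :
    map f n (sd n c) = sd n (map f n c) := by
  refine LinearMap.congr_fun (f := map f n ∘ₗ sd n) (g := sd n ∘ₗ map f n)
    (hom_ext fun σ => ?_) c
  rw [LinearMap.comp_apply, LinearMap.comp_apply, sd, lift_single, map_realize, map_single,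
    sd, lift_single]

lemma map_boundary (f : C(Y, Z)) {n : ℕ} (c : SingChain Y (n + 1)) :
    map f n (boundary n c) = boundary n (map f (n + 1) c) := by
  refine LinearMap.congr_fun (f := map f n ∘ₗ boundary n) (g := boundary n ∘ₗ map f (n + 1))
    (hom_ext fun σ => ?_) c
  rw [LinearMap.comp_apply, LinearMap.comp_apply, boundary, lift_single, map_realize, map_single,
    boundary, lift_single]

/-- The chains whose simplices have their image in `B`. -/
def chainsIn (B : Set Y) (n : ℕ) : Submodule ℤ (SingChain Y n) :=
  Finsupp.supported ℤ ℤ {σ | Set.range σ ⊆ B}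

lemma single_mem_chainsIn {B : Set Y} {n : ℕ} {σ : C(TopSimplex n, Y)} (h : Set.range σ ⊆ B)
    (a : ℤ) : Finsupp.single σ a ∈ chainsIn B n :=
  Finsupp.single_mem_supported ℤ _ h

lemma chainsIn_le {B : Set Y} {n : ℕ} {p : Submodule ℤ (SingChain Y n)}
    (h : ∀ σ : C(TopSimplex n, Y), Set.range σ ⊆ B → Finsupp.single σ 1 ∈ p) :
    chainsIn B n ≤ p := by
  rw [chainsIn, Finsupp.supported_eq_span_single, Submodule.span_le]
  rintro _ ⟨σ, hσ, rfl⟩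
  exact h σ hσ

lemma realize_mem_chainsIn {B : Set Y} {n k : ℕ} {σ : C(TopSimplex n, Y)} (h : Set.range σ ⊆ B)
    (c : TupleChain (TopSimplex n) (k + 1)) : realize σ k c ∈ chainsIn B k := by
  suffices ⊤ ≤ (chainsIn B k).comap (realize σ k) from this trivial
  rw [← Finsupp.supported_univ, Finsupp.supported_eq_span_single, Submodule.span_le]
  rintro _ ⟨v, -, rfl⟩
  rw [SetLike.mem_coe, Submodule.mem_comap, realize_single]
  refine single_mem_chainsIn ?_ 1
  rintro _ ⟨t, rfl⟩
  exact h ⟨_, rfl⟩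

lemma boundary_mem_chainsIn {B : Set Y} {n : ℕ} {c : SingChain Y (n + 1)}
    (hc : c ∈ chainsIn B (n + 1)) : boundary n c ∈ chainsIn B n := by
  refine chainsIn_le (p := (chainsIn B n).comap (boundary n)) (fun σ hσ => ?_) hc
  rw [Submodule.mem_comap, boundary, lift_single]
  exact realize_mem_chainsIn hσ _

lemma sd_mem_chainsIn {B : Set Y} {n : ℕ} {c : SingChain Y n}
    (hc : c ∈ chainsIn B n) : sd n c ∈ chainsIn B n := by
  refine chainsIn_le (p := (chainsIn B n).comap (sd n)) (fun σ hσ => ?_) hc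
  rw [Submodule.mem_comap, sd, lift_single]
  exact realize_mem_chainsIn hσ _

lemma sdHomotopy_mem_chainsIn {B : Set Y} {n : ℕ} {c : SingChain Y n}
    (hc : c ∈ chainsIn B n) : sdHomotopy n c ∈ chainsIn B (n + 1) := by
  refine chainsIn_le (p := (chainsIn B (n + 1)).comap (sdHomotopy n)) (fun σ hσ => ?_) hc
  rw [Submodule.mem_comap, sdHomotopy, lift_single]
  exact realize_mem_chainsIn hσ _

lemma sd_iterate_mem_chainsIn {B : Set Y} {n : ℕ} {c : SingChain Y n}
    (hc : c ∈ chainsIn B n) (N : ℕ) : (sd n)^[N] c ∈ chainsIn B n := by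
  induction N with
  | zero => exact hc
  | succ N ih => rw [Function.iterate_succ_apply']; exact sd_mem_chainsIn ih

/-- A singular simplex becomes small of order an open cover after finitely many subdivisions. -/
lemma exists_sd_iterate_single_mem {U V : Set Y} (hU : IsOpen U) (hV : IsOpen V)
    (hUV : U ∪ V = Set.univ) {n : ℕ} (σ : C(TopSimplex n, Y)) :
    ∃ N, ∀ M ≥ N, (sd n)^[M] (Finsupp.single σ 1) ∈ chainsIn U n ⊔ chainsIn V n := by
  -- A Lebesgue number of the pulled back cover. Iterated subdivision makes the diameters smaller
  -- than `δ`, and then each small simplex lies in the ball around its first vertex.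
  obtain ⟨δ, hδ, hball⟩ := lebesgue_number_lemma_of_metric (s := (Set.univ : Set (TopSimplex n)))
    isCompact_univ (c := fun b : Bool => σ ⁻¹' (cond b U V))
    (fun b => by cases b; exacts [hV.preimage σ.continuous, hU.preimage σ.continuous])
    (fun t _ => by
      have : σ t ∈ U ∪ V := hUV ▸ Set.mem_univ _
      rcases this with h | h
      · exact Set.mem_iUnion.2 ⟨true, h⟩
      · exact Set.mem_iUnion.2 ⟨false, h⟩)
  have hlt : (n / (n + 1) : ℝ) < 1 := by rw [div_lt_one (by positivity)]; linarith
  obtain ⟨N, hN⟩ := exists_pow_lt_of_lt_one hδ hlt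
  refine ⟨N, fun M hM => ?_⟩
  have hpow : (n / (n + 1) : ℝ) ^ M < δ :=
    (pow_le_pow_of_le_one (by positivity) hlt.le hM).trans_lt hN
  have hiter : ∀ M, (sd n)^[M] (Finsupp.single σ 1) =
      realize σ n ((TupleChain.sd (baryPoint n) (n + 1))^[M] (Finsupp.single (vertices n) 1)) := by
    intro M
    induction M with
    | zero => simp
    | succ M ih => rw [Function.iterate_succ_apply', Function.iterate_succ_apply', ih, realize_sd]
  rw [hiter]
  have hmem := sd_iterate_mem_supported_tuplesOfDiam n M
  rw [Finsupp.supported_eq_span_single] at hmem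
  refine (Submodule.span_le (p := (chainsIn U n ⊔ chainsIn V n).comap (realize σ n))).2 ?_ hmem
  rintro _ ⟨w, hw, rfl⟩
  rw [SetLike.mem_coe, Submodule.mem_comap, realize_single]
  obtain ⟨b, hb⟩ := hball (w 0) trivial
  have hrange : Set.range (σ.comp (affineMap w)) ⊆ cond b U V := by
    rintro _ ⟨t, rfl⟩
    exact hb (Metric.mem_ball.2
      ((dist_affineMap_le w t (w 0) fun i => hw i 0).trans_lt hpow))
  cases b
  · exact Submodule.mem_sup_right (single_mem_chainsIn hrange 1)
  · exact Submodule.mem_sup_left (single_mem_chainsIn hrange 1)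

/-- The bound is stated for all large exponents so that one exponent serves every simplex of the
chain. -/
lemma exists_sd_iterate_mem {U V : Set Y} (hU : IsOpen U) (hV : IsOpen V)
    (hUV : U ∪ V = Set.univ) {n : ℕ} (c : SingChain Y n) :
    ∃ N, ∀ M ≥ N, (sd n)^[M] c ∈ chainsIn U n ⊔ chainsIn V n := by
  have hc : c ∈ Submodule.span ℤ ((fun σ => Finsupp.single σ (1 : ℤ)) '' Set.univ) := by
    rw [← Finsupp.supported_eq_span_single, Finsupp.supported_univ]; trivial
  have hpow : ∀ M (x : SingChain Y n), (sd n)^[M] x = (sd n ^ M) x := fun M x => by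
    rw [Module.End.pow_apply]
  simp only [hpow]
  refine Submodule.span_induction
    (p := fun c _ => ∃ N, ∀ M ≥ N, (sd n ^ M) c ∈ chainsIn U n ⊔ chainsIn V n) ?_ ?_ ?_ ?_ hc
  · rintro _ ⟨σ, -, rfl⟩
    simpa only [hpow] using exists_sd_iterate_single_mem hU hV hUV σ
  · exact ⟨0, fun M _ => by rw [map_zero]; exact Submodule.zero_mem _⟩
  · rintro x y - - ⟨N, hN⟩ ⟨N', hN'⟩
    refine ⟨max N N', fun M hM => ?_⟩
    rw [map_add]
    exact Submodule.add_mem _ (hN M (le_of_max_le_left hM)) (hN' M (le_of_max_le_right hM))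
  · rintro a x - ⟨N, hN⟩
    refine ⟨N, fun M hM => ?_⟩
    rw [map_zsmul]
    exact Submodule.smul_mem _ _ (hN M hM)

end SingChain

/-! ### The singular chain complex in terms of finitely supported functions -/

section Identification

open scoped Simplicial

/-- The coefficient module of `singularChains`. -/
abbrev coeffs : ModuleCat.{u} ℤ := ModuleCat.of ℤ (ULift.{u} ℤ)

/-- The generator of the singular chains given by a singular simplex. -/
def simplexGen {Y : TopCat.{u}} {n : ℕ} (σ : C(TopSimplex n, Y)) : (singularChains Y).X n :=
  ((TopCat.toSSet.obj Y).ιChainComplex (R := coeffs.{u})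
    ((Y.toSSetObjEquiv (.op ⦋n⦌)).symm σ)).hom (ULift.up 1)

/-- Maps out of the singular chains, constructed from their values on simplices. -/
def chainsToSing (Y : TopCat.{u}) (n : ℕ) : (singularChains Y).X n →ₗ[ℤ] SingChain Y n :=
  (Cofan.IsColimit.desc ((TopCat.toSSet.obj Y).isColimitChainComplexXCofan coeffs.{u} n)
    (A := ModuleCat.of ℤ (SingChain Y n)) fun s =>
      ModuleCat.ofHom (Finsupp.lsingle (Y.toSSetObjEquiv (.op ⦋n⦌) s) ∘ₗ
        (ULift.moduleEquiv (R := ℤ) (M := ℤ)).toLinearMap)).hom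

lemma chainsToSing_simplexGen {Y : TopCat.{u}} {n : ℕ} (σ : C(TopSimplex n, Y)) :
    chainsToSing Y n (simplexGen σ) = Finsupp.single σ 1 := by
  have h := Cofan.IsColimit.fac ((TopCat.toSSet.obj Y).isColimitChainComplexXCofan coeffs.{u} n)
    (A := ModuleCat.of ℤ (SingChain Y n)) (fun s =>
      ModuleCat.ofHom (Finsupp.lsingle (Y.toSSetObjEquiv (.op ⦋n⦌) s) ∘ₗ
        (ULift.moduleEquiv (R := ℤ) (M := ℤ)).toLinearMap)) ((Y.toSSetObjEquiv (.op ⦋n⦌)).symm σ)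
  have h' := LinearMap.congr_fun (congrArg ModuleCat.Hom.hom h) (ULift.up 1)
  refine h'.trans ?_
  simp

lemma chains_hom_ext {Y : TopCat.{u}} {n : ℕ} {M : Type u} [AddCommGroup M] [Module ℤ M]
    {f g : (singularChains Y).X n →ₗ[ℤ] M}
    (h : ∀ σ, f (simplexGen σ) = g (simplexGen σ)) : f = g := by
  have key : ModuleCat.ofHom f = (ModuleCat.ofHom g : (singularChains Y).X n ⟶ _) := by
    refine SSet.chainComplex_hom_ext (X := TopCat.toSSet.obj Y) (R := coeffs.{u}) fun s => ?_
    obtain ⟨σ, rfl⟩ := (Y.toSSetObjEquiv (.op ⦋n⦌)).symm.surjective s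
    refine ModuleCat.hom_ext (LinearMap.ext fun a => ?_)
    exact LinearMap.congr_fun (LinearMap.ext_ring
      (f := ((TopCat.toSSet.obj Y).ιChainComplex _ ≫ ModuleCat.ofHom f).hom ∘ₗ
        (ULift.moduleEquiv (R := ℤ) (M := ℤ)).symm.toLinearMap)
      (g := ((TopCat.toSSet.obj Y).ιChainComplex _ ≫ ModuleCat.ofHom g).hom ∘ₗ
        (ULift.moduleEquiv (R := ℤ) (M := ℤ)).symm.toLinearMap) (h σ)) a.down
  exact congrArg ModuleCat.Hom.hom key

/-- Singular chains are integral combinations of singular simplices. -/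
def chainsEquiv (Y : TopCat.{u}) (n : ℕ) : (singularChains Y).X n ≃ₗ[ℤ] SingChain Y n :=
  LinearEquiv.ofLinearMap (chainsToSing Y n) (SingChain.lift simplexGen)
    (SingChain.hom_ext fun σ => by simp [chainsToSing_simplexGen])
    (chains_hom_ext fun σ => by simp [chainsToSing_simplexGen])

@[simp] lemma chainsEquiv_simplexGen {Y : TopCat.{u}} {n : ℕ} (σ : C(TopSimplex n, Y)) :
    chainsEquiv Y n (simplexGen σ) = Finsupp.single σ 1 :=
  chainsToSing_simplexGen σ

lemma toSSetObjEquiv_symm_δ {Y : TopCat.{u}} {n : ℕ} (σ : C(TopSimplex (n + 1), Y))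
    (i : Fin (n + 2)) :
    (TopCat.toSSet.obj Y).δ i ((Y.toSSetObjEquiv (.op ⦋n + 1⦌)).symm σ) =
      (Y.toSSetObjEquiv (.op ⦋n⦌)).symm
        (σ.comp (affineMap (vertices (n + 1) ∘ i.succAbove))) := by
  apply (Y.toSSetObjEquiv (.op ⦋n⦌)).injective
  rw [Equiv.apply_symm_apply]
  ext t
  change σ (stdSimplex.map i.succAbove t) = σ _
  congr 1
  refine Subtype.ext (funext fun j => ?_)
  change stdSimplex.map i.succAbove t j = _
  rw [stdSimplex.map_coe, FunOnFinite.linearMap_apply_apply]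
  simp [affineMap, vertices, Pi.single_apply, Finset.sum_filter, eq_comm]
  rfl

lemma chainsEquiv_d {Y : TopCat.{u}} {n : ℕ} (c : (singularChains Y).X (n + 1)) :
    chainsEquiv Y n ((singularChains Y).d (n + 1) n c) =
      SingChain.boundary n (chainsEquiv Y (n + 1) c) := by
  refine LinearMap.congr_fun (f := (chainsEquiv Y n).toLinearMap ∘ₗ
      ((singularChains Y).d (n + 1) n).hom)
    (g := SingChain.boundary n ∘ₗ (chainsEquiv Y (n + 1)).toLinearMap) (chains_hom_ext fun σ => ?_) c
  have h := LinearMap.congr_fun (congrArg ModuleCat.Hom.hom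
    ((TopCat.toSSet.obj Y).ιChainComplex_d (R := coeffs.{u})
      ((Y.toSSetObjEquiv (.op ⦋n + 1⦌)).symm σ))) (ULift.up 1)
  have h' : ((singularChains Y).d (n + 1) n) (simplexGen σ) = ∑ i : Fin (n + 2),
      (-1 : ℤ) ^ (i : ℕ) • simplexGen (σ.comp (affineMap (vertices (n + 1) ∘ i.succAbove))) := by
    refine h.trans ?_
    simp only [ModuleCat.hom_sum, LinearMap.sum_apply, ModuleCat.hom_zsmul, toSSetObjEquiv_symm_δ]
    rfl
  simp only [LinearMap.comp_apply, LinearEquiv.coe_coe, chainsEquiv_simplexGen]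
  erw [h']
  simp [SingChain.boundary]

lemma chainsEquiv_map {Y Z : TopCat.{u}} (f : Y ⟶ Z) {n : ℕ} (c : (singularChains Y).X n) :
    chainsEquiv Z n ((singularChainsMap f).f n c) = SingChain.map f.hom n (chainsEquiv Y n c) := by
  refine LinearMap.congr_fun (f := (chainsEquiv Z n).toLinearMap ∘ₗ
      ((singularChainsMap f).f n).hom)
    (g := SingChain.map f.hom n ∘ₗ (chainsEquiv Y n).toLinearMap) (chains_hom_ext fun σ => ?_) c
  have h := LinearMap.congr_fun (congrArg ModuleCat.Hom.hom
    (SSet.ι_chainComplexMap_f (f := TopCat.toSSet.map f) (R := coeffs.{u})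
      (x := (Y.toSSetObjEquiv (.op ⦋n⦌)).symm σ))) (ULift.up 1)
  have h' : ((singularChainsMap f).f n) (simplexGen σ) = simplexGen (f.hom.comp σ) := h
  simp only [LinearMap.comp_apply, LinearEquiv.coe_coe, chainsEquiv_simplexGen]
  erw [h']
  simp

end Identification

/-! ### Elements of homology modules -/

section Elements

variable {K L : ChainComplex (ModuleCat.{u} ℤ) ℕ}

/-- For `n = 0` the truncated index `n - 1` is again `0`. The differential vanishes there, so the
hypothesis is void, as it should be. -/
lemma exists_cycle {n : ℕ} (x : K.X n) (hx : K.d n (n - 1) x = 0) :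
    ∃ z : K.cycles n, K.iCycles n z = x := by
  have h := ShortComplex.exact_of_f_is_kernel
    (ShortComplex.mk (K.iCycles n) (K.d n (n - 1)) (K.iCycles_d n (n - 1)))
    (K.cyclesIsKernel n (n - 1) (by cases n <;> simp))
  rw [ShortComplex.moduleCat_exact_iff] at h
  exact h x hx

lemma iCycles_injective (n : ℕ) : Function.Injective (K.iCycles n) :=
  (ModuleCat.mono_iff_injective _).1 inferInstance

lemma homologyπ_surjective (n : ℕ) : Function.Surjective (K.homologyπ n) :=
  (ModuleCat.epi_iff_surjective _).1 inferInstance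

lemma d_iCycles {n m : ℕ} (z : K.cycles n) : K.d n m (K.iCycles n z) = 0 :=
  LinearMap.congr_fun (congrArg ModuleCat.Hom.hom (K.iCycles_d n m)) z

lemma iCycles_toCycles {n m : ℕ} (w : K.X m) :
    K.iCycles n (K.toCycles m n w) = K.d m n w :=
  LinearMap.congr_fun (congrArg ModuleCat.Hom.hom (K.toCycles_i m n)) w

lemma homologyπ_eq_zero_iff {n : ℕ} (z : K.cycles n) :
    K.homologyπ n z = 0 ↔ ∃ w, K.toCycles (n + 1) n w = z := by
  have h := ShortComplex.exact_of_g_is_cokernel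
    (ShortComplex.mk (K.toCycles (n + 1) n) (K.homologyπ n) (K.toCycles_comp_homologyπ _ _))
    (K.homologyIsCokernel (n + 1) n (by simp))
  rw [ShortComplex.moduleCat_exact_iff] at h
  refine ⟨h z, ?_⟩
  rintro ⟨w, rfl⟩
  exact LinearMap.congr_fun (congrArg ModuleCat.Hom.hom (K.toCycles_comp_homologyπ (n + 1) n)) w

/-- A chain map is a quasi-isomorphism if it induces a bijection on homology classes, phrased in
terms of cycles and boundaries. -/
lemma quasiIso_of_elements (f : K ⟶ L)
    (hsurj : ∀ n (y : L.X n), L.d n (n - 1) y = 0 →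
      ∃ x : K.X n, K.d n (n - 1) x = 0 ∧ ∃ w : L.X (n + 1), f.f n x - y = L.d (n + 1) n w)
    (hinj : ∀ n (x : K.X n), K.d n (n - 1) x = 0 → (∃ w : L.X (n + 1), f.f n x = L.d (n + 1) n w) →
      ∃ w : K.X (n + 1), x = K.d (n + 1) n w) : QuasiIso f := by
  rw [quasiIso_iff]
  intro n
  rw [quasiIsoAt_iff_isIso_homologyMap]
  have hmap : ∀ z : K.cycles n, HomologicalComplex.homologyMap f n (K.homologyπ n z) =
      L.homologyπ n (HomologicalComplex.cyclesMap f n z) := fun z =>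
    LinearMap.congr_fun (congrArg ModuleCat.Hom.hom
      (HomologicalComplex.homologyπ_naturality f n)) z
  have hcyc : ∀ z : K.cycles n, L.iCycles n (HomologicalComplex.cyclesMap f n z) =
      f.f n (K.iCycles n z) := fun z =>
    LinearMap.congr_fun (congrArg ModuleCat.Hom.hom (HomologicalComplex.cyclesMap_i f n)) z
  rw [ConcreteCategory.isIso_iff_bijective]
  constructor
  · rw [← ModuleCat.mono_iff_injective, ModuleCat.mono_iff_ker_eq_bot, LinearMap.ker_eq_bot']
    intro h hh
    obtain ⟨z, rfl⟩ := homologyπ_surjective n h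
    have hh' : L.homologyπ n (HomologicalComplex.cyclesMap f n z) = 0 := (hmap z).symm.trans hh
    obtain ⟨w, hw⟩ := (homologyπ_eq_zero_iff _).1 hh'
    obtain ⟨v, hv⟩ := hinj n (K.iCycles n z) (d_iCycles z)
      ⟨w, by rw [← hcyc, ← hw, iCycles_toCycles]⟩
    refine (homologyπ_eq_zero_iff _).2 ⟨v, iCycles_injective n ?_⟩
    rw [iCycles_toCycles, hv]
  · intro h
    obtain ⟨z, rfl⟩ := homologyπ_surjective n h
    obtain ⟨x, hx, w, hw⟩ := hsurj n (L.iCycles n z) (d_iCycles z)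
    obtain ⟨z', rfl⟩ := exists_cycle x hx
    refine ⟨K.homologyπ n z', ?_⟩
    rw [hmap, ← sub_eq_zero, ← map_sub, homologyπ_eq_zero_iff]
    refine ⟨w, iCycles_injective n ?_⟩
    rw [iCycles_toCycles, map_sub, hcyc, hw]

end Elements

/-! ### Relative chains -/

section Relative

variable {Y Z : Type u} [TopologicalSpace Y] [TopologicalSpace Z]

lemma singularChainsMap_comp {Y Z W : TopCat.{u}} (f : Y ⟶ Z) (g : Z ⟶ W) :
    singularChainsMap (f ≫ g) = singularChainsMap f ≫ singularChainsMap g :=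
  CategoryTheory.Functor.map_comp _ f g

lemma singularChainsMap_id (Y : TopCat.{u}) : singularChainsMap (𝟙 Y) = 𝟙 _ :=
  CategoryTheory.Functor.map_id _ Y

instance (B : Set Y) : Mono (subspaceIncl Y B) :=
  (TopCat.mono_iff_injective _).2 Subtype.val_injective

instance {Y Z : TopCat.{u}} (f : Y ⟶ Z) [Mono f] : Mono (singularChainsMap f) := by
  have : ((AlgebraicTopology.singularChainComplexFunctor (ModuleCat.{u} ℤ)).obj
    (ModuleCat.of ℤ (ULift.{u} ℤ))).PreservesMonomorphisms := inferInstance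
  exact Functor.map_mono _ f

/-- The short complex `C_•(B) ⟶ C_•(Y) ⟶ C_•(Y, B)`. -/
def pairShortComplex (Y : Type u) [TopologicalSpace Y] (B : Set Y) :
    ShortComplex (ChainComplex (ModuleCat.{u} ℤ) ℕ) :=
  ShortComplex.mk (singularChainsMap (subspaceIncl Y B)) (cokernel.π _) (cokernel.condition _)

lemma pairShortComplex_shortExact (Y : Type u) [TopologicalSpace Y] (B : Set Y) :
    (pairShortComplex Y B).ShortExact := by
  have : Mono (pairShortComplex Y B).f := by dsimp [pairShortComplex]; infer_instance
  have : Epi (pairShortComplex Y B).g := by dsimp [pairShortComplex]; infer_instance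
  exact { exact := ShortComplex.exact_cokernel _ }

/-- The projection onto relative chains. -/
def relProj (Y : Type u) [TopologicalSpace Y] (B : Set Y) :
    singularChains (TopCat.of Y) ⟶ relChains Y B :=
  cokernel.π _

lemma relProj_surjective (B : Set Y) (n : ℕ) : Function.Surjective ((relProj Y B).f n) := by
  have h := ((HomologicalComplex.shortExact_iff_degreewise_shortExact _).1
    (pairShortComplex_shortExact Y B) n).epi_g
  exact (ModuleCat.epi_iff_surjective _).1 h

lemma SingChain.range_map_subspaceIncl (B : Set Y) (n : ℕ) :
    LinearMap.range (SingChain.map (subspaceIncl Y B).hom n) = SingChain.chainsIn B n := by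
  refine le_antisymm ?_ (SingChain.chainsIn_le fun σ hσ => ?_)
  · rw [LinearMap.range_le_iff_comap, eq_top_iff, ← Finsupp.supported_univ,
      Finsupp.supported_eq_span_single, Submodule.span_le]
    rintro _ ⟨σ, -, rfl⟩
    rw [SetLike.mem_coe, Submodule.mem_comap, SingChain.map_single]
    refine SingChain.single_mem_chainsIn ?_ 1
    rintro _ ⟨t, rfl⟩
    exact (σ t).2
  · refine ⟨Finsupp.single ⟨fun t => (⟨σ t, hσ ⟨t, rfl⟩⟩ : B), by fun_prop⟩ 1, ?_⟩
    rw [SingChain.map_single]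
    rfl

/-- Degreewise exactness identifies the kernel with the chains coming from `B`. This makes the
abstract cokernel accessible to computations with explicit chains. -/
lemma relProj_eq_zero_iff (B : Set Y) {n : ℕ} (c : (singularChains (TopCat.of Y)).X n) :
    (relProj Y B).f n c = 0 ↔ chainsEquiv _ n c ∈ SingChain.chainsIn B n := by
  have h := ((HomologicalComplex.shortExact_iff_degreewise_shortExact _).1
    (pairShortComplex_shortExact Y B) n).exact
  rw [ShortComplex.moduleCat_exact_iff] at h
  rw [← SingChain.range_map_subspaceIncl]
  constructor
  · intro hc
    obtain ⟨b, hb⟩ := h c hc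
    exact ⟨chainsEquiv _ n b, (chainsEquiv_map _ _).symm.trans (congrArg (chainsEquiv _ n) hb)⟩
  · rintro ⟨b, hb⟩
    obtain ⟨b, rfl⟩ := (chainsEquiv _ n).surjective b
    rw [← chainsEquiv_map] at hb
    rw [← (chainsEquiv _ n).injective hb]
    exact LinearMap.congr_fun (congrArg ModuleCat.Hom.hom (congrArg (fun g => g.f n)
      (cokernel.condition (singularChainsMap (subspaceIncl Y B))))) b

/-- The restriction of a map of pairs to the subspaces. -/
def restrictMap (f : C(Y, Z)) {B : Set Y} {B' : Set Z} (h : Set.MapsTo f B B') :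
    TopCat.of B ⟶ TopCat.of B' :=
  TopCat.ofHom ⟨h.restrict, f.continuous.restrict h⟩

/-- The map of short complexes induced by a map of pairs. -/
def pairShortComplexMap (f : C(Y, Z)) {B : Set Y} {B' : Set Z} (h : Set.MapsTo f B B') :
    pairShortComplex Y B ⟶ pairShortComplex Z B' where
  τ₁ := singularChainsMap (restrictMap f h)
  τ₂ := singularChainsMap (TopCat.ofHom f)
  τ₃ := cokernel.map _ _ (singularChainsMap (restrictMap f h)) (singularChainsMap (TopCat.ofHom f))
    (by rw [← singularChainsMap_comp, ← singularChainsMap_comp]; rfl)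
  comm₁₂ := by
    dsimp [pairShortComplex]
    rw [← singularChainsMap_comp, ← singularChainsMap_comp]; rfl
  comm₂₃ := by simp [pairShortComplex]

/-- The chain map on relative chains induced by a map of pairs. -/
def relChainsMap (f : C(Y, Z)) {B : Set Y} {B' : Set Z} (h : Set.MapsTo f B B') :
    relChains Y B ⟶ relChains Z B' :=
  (pairShortComplexMap f h).τ₃

lemma relChainsMap_relProj (f : C(Y, Z)) {B : Set Y} {B' : Set Z} (h : Set.MapsTo f B B') {n : ℕ}
    (c : (singularChains (TopCat.of Y)).X n) :
    (relChainsMap f h).f n ((relProj Y B).f n c) =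
      (relProj Z B').f n ((singularChainsMap (TopCat.ofHom f)).f n c) :=
  (LinearMap.congr_fun (congrArg ModuleCat.Hom.hom (congrArg (fun g => g.f n)
    (pairShortComplexMap f h).comm₂₃)) c).symm

/-- A map of pairs that induces quasi-isomorphisms on both spaces induces one on relative chains. -/
lemma quasiIso_relChainsMap (f : C(Y, Z)) {B : Set Y} {B' : Set Z} (h : Set.MapsTo f B B')
    (h₁ : QuasiIso (singularChainsMap (restrictMap f h)))
    (h₂ : QuasiIso (singularChainsMap (TopCat.ofHom f))) : QuasiIso (relChainsMap f h) :=
  HomologicalComplex.HomologySequence.quasiIso_τ₃ (pairShortComplexMap f h)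
    (pairShortComplex_shortExact Y B) (pairShortComplex_shortExact Z B') h₁ h₂

/-- A continuous map with a homotopy inverse induces a quasi-isomorphism. -/
lemma quasiIso_singularChainsMap {Y Z : TopCat.{u}} (f : Y ⟶ Z) (g : Z ⟶ Y)
    (H : TopCat.Homotopy (f ≫ g) (𝟙 Y)) (H' : TopCat.Homotopy (g ≫ f) (𝟙 Z)) :
    QuasiIso (singularChainsMap f) := by
  rw [quasiIso_iff]
  intro n
  rw [quasiIsoAt_iff_isIso_homologyMap]
  refine ⟨HomologicalComplex.homologyMap (singularChainsMap g) n, ?_, ?_⟩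
  · rw [← HomologicalComplex.homologyMap_comp, ← singularChainsMap_comp,
      ← HomologicalComplex.homologyMap_id, ← singularChainsMap_id]
    exact H.congr_homologyMap_singularChainComplexFunctor _ n
  · rw [← HomologicalComplex.homologyMap_comp, ← singularChainsMap_comp,
      ← HomologicalComplex.homologyMap_id, ← singularChainsMap_id]
    exact H'.congr_homologyMap_singularChainComplexFunctor _ n

/-- The isomorphism on relative homology induced by a quasi-isomorphism of relative chains. -/
lemma nonempty_relHomology_equiv {B : Set Y} {B' : Set Z} (f : relChains Y B ⟶ relChains Z B')
    [QuasiIso f] (i : ℕ) : Nonempty (relHomology Y B i ≃ₗ[ℤ] relHomology Z B' i) :=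
  ⟨(isoOfQuasiIsoAt f i).toLinearEquiv⟩

end Relative

/-! ### Excision -/

namespace SingChain

variable {Y Z : Type*} [TopologicalSpace Y] [TopologicalSpace Z]

/-- The relative cycles of the pair `(Y, B)`. -/
def relCycles (B : Set Y) : ∀ n, Submodule ℤ (SingChain Y n)
  | 0 => ⊤
  | n + 1 => (chainsIn B n).comap (boundary n)

/-- The relative boundaries of the pair `(Y, B)`. -/
def relBoundaries (B : Set Y) (n : ℕ) : Submodule ℤ (SingChain Y n) :=
  LinearMap.range (boundary n) ⊔ chainsIn B n

lemma mem_relBoundaries {B : Set Y} {n : ℕ} {c : SingChain Y n} :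
    c ∈ relBoundaries B n ↔ ∃ w, c - boundary n w ∈ chainsIn B n := by
  rw [relBoundaries, Submodule.mem_sup]
  constructor
  · rintro ⟨_, ⟨w, rfl⟩, b, hb, rfl⟩
    exact ⟨w, by simpa using hb⟩
  · rintro ⟨w, hw⟩
    exact ⟨_, ⟨w, rfl⟩, _, hw, by abel⟩

lemma chainsIn_le_relCycles (B : Set Y) (n : ℕ) : chainsIn B n ≤ relCycles B n := by
  cases n with
  | zero => exact le_top
  | succ n => exact fun c hc => boundary_mem_chainsIn hc

lemma chainsIn_le_relBoundaries (B : Set Y) (n : ℕ) : chainsIn B n ≤ relBoundaries B n :=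
  le_sup_right

lemma boundary_mem_relBoundaries (B : Set Y) {n : ℕ} (w : SingChain Y (n + 1)) :
    boundary n w ∈ relBoundaries B n :=
  (le_sup_left : LinearMap.range (boundary n) ≤ relBoundaries B n) ⟨w, rfl⟩

lemma sd_mem_relCycles {B : Set Y} {n : ℕ} {c : SingChain Y n} (hc : c ∈ relCycles B n) :
    sd n c ∈ relCycles B n := by
  cases n with
  | zero => trivial
  | succ n =>
    change boundary n (sd (n + 1) c) ∈ chainsIn B n
    rw [boundary_sd]
    exact sd_mem_chainsIn hc

lemma sub_sd_mem_relBoundaries {B : Set Y} {n : ℕ} {c : SingChain Y n} (hc : c ∈ relCycles B n) :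
    c - sd n c ∈ relBoundaries B n := by
  cases n with
  | zero =>
    rw [← boundary_sdHomotopy_zero]
    exact boundary_mem_relBoundaries B _
  | succ n =>
    rw [← boundary_sdHomotopy]
    exact Submodule.add_mem _ (boundary_mem_relBoundaries B _)
      (chainsIn_le_relBoundaries B _ (sdHomotopy_mem_chainsIn hc))

lemma sd_iterate_mem_relCycles {B : Set Y} {n : ℕ} {c : SingChain Y n} (hc : c ∈ relCycles B n)
    (N : ℕ) : (sd n)^[N] c ∈ relCycles B n := by
  induction N with
  | zero => exact hc
  | succ N ih => rw [Function.iterate_succ_apply']; exact sd_mem_relCycles ih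

lemma sub_sd_iterate_mem_relBoundaries {B : Set Y} {n : ℕ} {c : SingChain Y n}
    (hc : c ∈ relCycles B n) (N : ℕ) : c - (sd n)^[N] c ∈ relBoundaries B n := by
  induction N with
  | zero => simp
  | succ N ih =>
    rw [Function.iterate_succ_apply']
    simpa using Submodule.add_mem _ ih (sub_sd_mem_relBoundaries (sd_iterate_mem_relCycles hc N))

lemma map_sd_iterate (f : C(Y, Z)) {n : ℕ} (c : SingChain Y n) (N : ℕ) :
    map f n ((sd n)^[N] c) = (sd n)^[N] (map f n c) := by
  induction N with
  | zero => rfl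
  | succ N ih => rw [Function.iterate_succ_apply', Function.iterate_succ_apply', map_sd, ih]

lemma boundary_sd_iterate {n : ℕ} (c : SingChain Y (n + 1)) (N : ℕ) :
    boundary n ((sd (n + 1))^[N] c) = (sd n)^[N] (boundary n c) := by
  induction N with
  | zero => rfl
  | succ N ih => rw [Function.iterate_succ_apply', Function.iterate_succ_apply', boundary_sd, ih]

lemma sd_iterate_sub {n : ℕ} (c c' : SingChain Y n) (N : ℕ) :
    (sd n)^[N] (c - c') = (sd n)^[N] c - (sd n)^[N] c' := by
  simp only [← Module.End.pow_apply, map_sub]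

lemma map_mem_chainsIn (f : C(Y, Z)) {B : Set Y} {B' : Set Z} (h : Set.MapsTo f B B') {n : ℕ}
    {c : SingChain Y n} (hc : c ∈ chainsIn B n) : map f n c ∈ chainsIn B' n := by
  refine chainsIn_le (p := (chainsIn B' n).comap (map f n)) (fun σ hσ => ?_) hc
  rw [Submodule.mem_comap, map_single]
  refine single_mem_chainsIn ?_ 1
  rintro _ ⟨t, rfl⟩
  exact h (hσ ⟨t, rfl⟩)

/-- Distinct simplices of `c` have distinct images because `q` is injective over `V'`. Hence nothing
cancels in the image chain, and each simplex can be tested separately. -/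
lemma mem_chainsIn_preimage (q : C(Y, Z)) {U' V' : Set Z} (hinj : Set.InjOn q (q ⁻¹' V')) {n : ℕ}
    {c : SingChain Y n} (hc : c ∈ chainsIn (q ⁻¹' V') n) (hq : map q n c ∈ chainsIn U' n) :
    c ∈ chainsIn (q ⁻¹' U') n := by
  rw [chainsIn, Finsupp.mem_supported] at hc hq ⊢
  intro σ hσ
  have hco : map q n c (q.comp σ) = c σ := by
    refine Finsupp.mapDomain_apply' _ c hc (fun σ₁ h₁ σ₂ h₂ h => ?_) (hc hσ)
    ext t
    exact hinj (h₁ ⟨t, rfl⟩) (h₂ ⟨t, rfl⟩) (DFunLike.congr_fun h t)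
  have hmem : q.comp σ ∈ (map q n c).support := by
    rw [Finsupp.mem_support_iff, hco]
    exact Finsupp.mem_support_iff.1 hσ
  rintro _ ⟨t, rfl⟩
  exact hq hmem ⟨t, rfl⟩

lemma exists_lift_chainsIn (q : C(Y, Z)) {V' : Set Z} {n : ℕ}
    (hlift : ∀ σ' : C(TopSimplex n, Z), Set.range σ' ⊆ V' → ∃ σ, q.comp σ = σ')
    {c' : SingChain Z n} (hc' : c' ∈ chainsIn V' n) :
    ∃ c ∈ chainsIn (q ⁻¹' V') n, map q n c = c' := by
  refine chainsIn_le (p := (chainsIn (q ⁻¹' V') n).map (map q n)) (fun σ' hσ' => ?_) hc'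
  obtain ⟨σ, rfl⟩ := hlift σ' hσ'
  refine ⟨Finsupp.single σ 1, single_mem_chainsIn ?_ 1, map_single _ _ _⟩
  rintro _ ⟨t, rfl⟩
  exact hσ' ⟨t, rfl⟩

section Excision

variable (q : C(Y, Z)) {U' V' : Set Z} (hU' : IsOpen U') (hV' : IsOpen V')
  (hcover : U' ∪ V' = Set.univ) (hinj : Set.InjOn q (q ⁻¹' V'))
  (hlift : ∀ n (σ' : C(TopSimplex n, Z)), Set.range σ' ⊆ V' → ∃ σ, q.comp σ = σ')

include hinj

lemma mem_relCycles_preimage {n : ℕ} {c : SingChain Y n} (hc : c ∈ chainsIn (q ⁻¹' V') n)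
    (hq : map q n c ∈ relCycles U' n) : c ∈ relCycles (q ⁻¹' U') n := by
  cases n with
  | zero => trivial
  | succ n =>
    refine mem_chainsIn_preimage q hinj (boundary_mem_chainsIn hc) ?_
    rw [map_boundary]
    exact hq

include hU' hV' hcover hlift

/-- After subdivision the relative cycle splits into a part in `U'`, which is negligible, and a part
in `V'`, which lifts through `q`. -/
lemma excision_surjective {n : ℕ} {z : SingChain Z n} (hz : z ∈ relCycles U' n) :
    ∃ v ∈ relCycles (q ⁻¹' U') n, map q n v - z ∈ relBoundaries U' n := by
  obtain ⟨N, hN⟩ := exists_sd_iterate_mem hU' hV' hcover z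
  obtain ⟨u', hu', v', hv', huv⟩ := Submodule.mem_sup.1 (hN N le_rfl)
  obtain ⟨v, hv, rfl⟩ := exists_lift_chainsIn q (hlift n) hv'
  have hqv : map q n v = (sd n)^[N] z - u' := by rw [← huv]; abel
  refine ⟨v, mem_relCycles_preimage q hinj hv ?_, ?_⟩
  · rw [hqv]
    exact Submodule.sub_mem _ (sd_iterate_mem_relCycles hz N) (chainsIn_le_relCycles _ _ hu')
  · rw [hqv, ← Submodule.neg_mem_iff]
    convert Submodule.add_mem _ (sub_sd_iterate_mem_relBoundaries hz N)
      (chainsIn_le_relBoundaries _ _ hu') using 1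
    abel

/-- Subdivide both `z` and the chain `w` that bounds its image, and lift the `V'`-part of `w`. The
`V'`-part of `z` minus the boundary of this lift maps into `U'`, so by injectivity over `V'` it
already lies over `U'`. -/
lemma excision_injective {n : ℕ} {z : SingChain Y n} (hz : z ∈ relCycles (q ⁻¹' U') n)
    (hq : map q n z ∈ relBoundaries U' n) : z ∈ relBoundaries (q ⁻¹' U') n := by
  obtain ⟨w, hw⟩ := mem_relBoundaries.1 hq
  obtain ⟨N₁, hN₁⟩ := exists_sd_iterate_mem (hU'.preimage q.continuous) (hV'.preimage q.continuous)
    (by rw [← Set.preimage_union, hcover, Set.preimage_univ]) z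
  obtain ⟨N₂, hN₂⟩ := exists_sd_iterate_mem hU' hV' hcover w
  -- The two chains must be subdivided equally often, so that subdivision commutes with the relation
  -- between them.
  set N := max N₁ N₂
  obtain ⟨a, ha, v, hv, hav⟩ := Submodule.mem_sup.1 (hN₁ N (le_max_left _ _))
  obtain ⟨b, hb, v', hv', hbv⟩ := Submodule.mem_sup.1 (hN₂ N (le_max_right _ _))
  obtain ⟨v'', hv'', rfl⟩ := exists_lift_chainsIn q (hlift _) hv'
  have hdiff : v - boundary n v'' ∈ chainsIn (q ⁻¹' U') n := by
    refine mem_chainsIn_preimage q hinj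
      (Submodule.sub_mem _ hv (boundary_mem_chainsIn hv'')) ?_
    have h₁ : map q n (v - boundary n v'') =
        (sd n)^[N] (map q n z - boundary n w) - map q n a + boundary n b := by
      rw [sd_iterate_sub, ← map_sd_iterate, ← boundary_sd_iterate, ← hav, ← hbv, map_sub,
        map_boundary, map_add, map_add]
      abel
    rw [h₁]
    exact Submodule.add_mem _ (Submodule.sub_mem _ (sd_iterate_mem_chainsIn hw N)
      (map_mem_chainsIn q (fun _ h => h) ha)) (boundary_mem_chainsIn hb)
  have h₂ : z = (z - (sd n)^[N] z) + a + (v - boundary n v'') + boundary n v'' := by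
    rw [← hav]; abel
  rw [h₂]
  exact Submodule.add_mem _ (Submodule.add_mem _ (Submodule.add_mem _
    (sub_sd_iterate_mem_relBoundaries hz N) (chainsIn_le_relBoundaries _ _ ha))
    (chainsIn_le_relBoundaries _ _ hdiff)) (boundary_mem_relBoundaries _ _)

end Excision

end SingChain

/-! ### Excision for the relative singular complexes -/

section RelClass

variable {Y Z : Type u} [TopologicalSpace Y] [TopologicalSpace Z]

/-- The relative chain represented by a singular chain. -/
def relClass (B : Set Y) (n : ℕ) : SingChain Y n →ₗ[ℤ] (relChains Y B).X n :=
  ((relProj Y B).f n).hom ∘ₗ (chainsEquiv (TopCat.of Y) n).symm.toLinearMap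

lemma relClass_surjective (B : Set Y) (n : ℕ) : Function.Surjective (relClass B n) :=
  (relProj_surjective B n).comp (chainsEquiv (TopCat.of Y) n).symm.surjective

lemma relClass_eq_zero_iff {B : Set Y} {n : ℕ} {c : SingChain Y n} :
    relClass B n c = 0 ↔ c ∈ SingChain.chainsIn B n := by
  refine (relProj_eq_zero_iff B _).trans ?_
  rw [LinearEquiv.coe_coe, LinearEquiv.apply_symm_apply]

lemma d_relClass (B : Set Y) {n : ℕ} (c : SingChain Y (n + 1)) :
    (relChains Y B).d (n + 1) n (relClass B (n + 1) c) = relClass B n (SingChain.boundary n c) := by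
  have h := LinearMap.congr_fun (congrArg ModuleCat.Hom.hom ((relProj Y B).comm (n + 1) n))
    ((chainsEquiv (TopCat.of Y) (n + 1)).symm c)
  refine h.trans (congrArg ((relProj Y B).f n) ?_)
  apply (chainsEquiv (TopCat.of Y) n).injective
  refine (chainsEquiv_d _).trans ?_
  simp

lemma relChainsMap_relClass (f : C(Y, Z)) {B : Set Y} {B' : Set Z} (h : Set.MapsTo f B B') {n : ℕ}
    (c : SingChain Y n) :
    (relChainsMap f h).f n (relClass B n c) = relClass B' n (SingChain.map f n c) := by
  refine (relChainsMap_relProj f h _).trans (congrArg ((relProj Z B').f n) ?_)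
  apply (chainsEquiv (TopCat.of Z) n).injective
  refine (chainsEquiv_map _ _).trans ?_
  simp

lemma d_relClass_eq_zero_iff {B : Set Y} {n : ℕ} {c : SingChain Y n} :
    (relChains Y B).d n (n - 1) (relClass B n c) = 0 ↔ c ∈ SingChain.relCycles B n := by
  cases n with
  | zero =>
    rw [(relChains Y B).shape 0 (0 - 1) (by simp)]
    simp [SingChain.relCycles]
  | succ n =>
    refine Iff.trans ?_ relClass_eq_zero_iff
    rw [← d_relClass]
    rfl

lemma relClass_mem_range_d_iff {B : Set Y} {n : ℕ} {c : SingChain Y n} :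
    (∃ w, relClass B n c = (relChains Y B).d (n + 1) n w) ↔ c ∈ SingChain.relBoundaries B n := by
  rw [(relClass_surjective B (n + 1)).exists, SingChain.mem_relBoundaries]
  refine exists_congr fun w => ?_
  rw [d_relClass, ← sub_eq_zero, ← map_sub, relClass_eq_zero_iff]

/-- **Excision**: a map that is injective over an open set `V'` and lifts simplices of `V'` induces
an isomorphism on homology relative to an open set `U'` that covers the target together with
`V'`. -/
lemma quasiIso_excision (q : C(Y, Z)) {U' V' : Set Z} (hU' : IsOpen U') (hV' : IsOpen V')
    (hcover : U' ∪ V' = Set.univ) (hinj : Set.InjOn q (q ⁻¹' V'))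
    (hlift : ∀ n (σ' : C(TopSimplex n, Z)), Set.range σ' ⊆ V' → ∃ σ, q.comp σ = σ') :
    QuasiIso (relChainsMap q (Set.mapsTo_preimage q U')) := by
  refine quasiIso_of_elements _ (fun n y hy => ?_) (fun n x hx hw => ?_)
  · obtain ⟨z, rfl⟩ := relClass_surjective _ n y
    obtain ⟨v, hv, hvz⟩ := SingChain.excision_surjective q hU' hV' hcover hinj hlift
      (d_relClass_eq_zero_iff.1 hy)
    refine ⟨relClass _ n v, d_relClass_eq_zero_iff.2 hv, ?_⟩
    rw [relChainsMap_relClass, ← map_sub]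
    exact relClass_mem_range_d_iff.2 hvz
  · obtain ⟨z, rfl⟩ := relClass_surjective _ n x
    rw [relChainsMap_relClass] at hw
    exact relClass_mem_range_d_iff.2 (SingChain.excision_injective q hU' hV' hcover hinj hlift
      (d_relClass_eq_zero_iff.1 hx) (relClass_mem_range_d_iff.1 hw))

end RelClass

/-! ### Maps into and out of pointed quotients -/

section Quotient

variable {X : Type u} {N L : Set X}

open scoped Classical in
/-- The class of a point in `N / L`, with the base point as value outside `N`. -/
def toQuot (N L : Set X) (x : X) : PointedQuotient N L :=
  if h : x ∈ N then Quot.mk _ (Sum.inl ⟨x, h⟩) else basePoint N L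

lemma toQuot_coe (y : N) : toQuot N L y = Quot.mk _ (Sum.inl y) := by
  rw [toQuot, dif_pos y.2]

lemma toQuot_of_notMem {x : X} (h : x ∉ N) : toQuot N L x = basePoint N L := by
  rw [toQuot, dif_neg h]

lemma toQuot_of_mem {x : X} (h : x ∈ L) : toQuot N L x = basePoint N L := by
  by_cases hN : x ∈ N
  · rw [toQuot, dif_pos hN]
    exact Quot.sound ⟨⟨x, hN⟩, h, rfl, rfl⟩
  · exact toQuot_of_notMem hN

lemma pointedQuotient_cases (p : PointedQuotient N L) :
    p = basePoint N L ∨ ∃ y ∈ N, p = toQuot N L y := by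
  obtain ⟨y | ⟨⟩, rfl⟩ := Quot.exists_rep p
  · exact Or.inr ⟨y, y.2, (toQuot_coe y).symm⟩
  · exact Or.inl rfl

/-- The map on `N / L` induced by a map on `N` that is constant on `L`. -/
def quotDescend {W : Type*} (f : N → W) (w : W) (h : ∀ y : N, (y : X) ∈ L → f y = w) :
    PointedQuotient N L → W :=
  Quot.lift (Sum.elim f fun _ => w) <| by
    rintro a b ⟨y, hy, rfl, rfl⟩
    exact h y hy

lemma quotDescend_toQuot {W : Type*} (f : N → W) (w : W) (h : ∀ y : N, (y : X) ∈ L → f y = w)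
    (y : N) : quotDescend f w h (toQuot N L y) = f y := by
  rw [toQuot_coe]
  rfl

variable [TopologicalSpace X]

lemma continuous_toQuot_coe : Continuous fun y : N => toQuot N L y := by
  simp only [toQuot_coe]
  exact continuous_quot_mk.comp continuous_inl

lemma continuousOn_toQuot : ContinuousOn (toQuot N L) N :=
  continuousOn_iff_continuous_domRestrict.2 continuous_toQuot_coe

lemma continuous_quotDescend {W : Type*} [TopologicalSpace W] {f : N → W} (hf : Continuous f)
    (w : W) (h : ∀ y : N, (y : X) ∈ L → f y = w) : Continuous (quotDescend f w h) :=
  continuous_quot_lift _ (continuous_sumElim.2 ⟨hf, continuous_const⟩)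

open scoped Classical in
/-- A map into `N / L` that is a continuous map to `X` where `P` holds and the base point elsewhere
is continuous if `P` can only change where the map takes values in `L`. -/
lemma continuous_ite_toQuot {Z : Type*} [TopologicalSpace Z] {P : Z → Prop} {g : Z → X}
    (hg : Continuous g) (hP : ∀ z, P z → g z ∈ N) (hLN : L ⊆ N)
    (h : ∀ z₀, (∀ᶠ z in 𝓝 z₀, P z) ∨ g z₀ ∈ L ∨ ∀ᶠ z in 𝓝 z₀, ¬ P z) :
    Continuous fun z => if P z then toQuot N L (g z) else basePoint N L := by
  refine continuous_iff_continuousAt.2 fun z₀ => ?_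
  rcases h z₀ with h | h | h
  · have hev : (fun z => toQuot N L (g z)) =ᶠ[𝓝 z₀]
        fun z => if P z then toQuot N L (g z) else basePoint N L := by
      filter_upwards [h] with z hz
      rw [if_pos hz]
    refine ContinuousAt.congr ?_ hev
    exact (continuousOn_toQuot (g z₀) (hP z₀ h.self_of_nhds)).tendsto.comp
      (tendsto_nhdsWithin_iff.2 ⟨hg.continuousAt, h.mono hP⟩)
  · have hval : (if P z₀ then toQuot N L (g z₀) else basePoint N L) = basePoint N L := by
      rw [toQuot_of_mem h, ite_self]
    rw [ContinuousAt, hval]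
    have ht : Filter.Tendsto g (𝓝 z₀ ⊓ Filter.principal {z | P z}) (𝓝[N] g z₀) :=
      tendsto_nhdsWithin_iff.2 ⟨hg.continuousAt.tendsto.mono_left inf_le_left,
        Filter.eventually_inf_principal.2 (.of_forall hP)⟩
    -- Where `g z₀` lies in `L`, both branches tend to the base point.
    refine Filter.Tendsto.if ?_ tendsto_const_nhds
    rw [← toQuot_of_mem h]
    exact (continuousOn_toQuot (g z₀) (hLN h)).tendsto.comp ht
  · have hev : (fun _ => basePoint N L) =ᶠ[𝓝 z₀]
        fun z => if P z then toQuot N L (g z) else basePoint N L := by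
      filter_upwards [h] with z hz
      rw [if_neg hz]
    exact continuousAt_const.congr hev

end Quotient

/-! ### Orbits in index pairs -/

section Orbits

variable {X : Type u} [TopologicalSpace X] {φ : Flow ℝ≥0 X}

lemma exists_mul_eq_of_le {s t : ℝ≥0} (h : s ≤ t) : ∃ r ∈ Set.Icc (0 : ℝ≥0) 1, r * t = s := by
  rcases eq_or_ne t 0 with rfl | ht
  · exact ⟨0, by simp, by simp [le_antisymm h zero_le]⟩
  · exact ⟨s / t, ⟨zero_le, div_le_one_of_le₀ h zero_le⟩, div_mul_cancel₀ s ht⟩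

/-- The length of the orbit segment varies with the point, so time is rescaled to the unit interval,
where the tube lemma applies. -/
lemma eventually_forall_le_mem {Z : Type*} [TopologicalSpace Z] {τ : Z → ℝ≥0} {g : Z → X}
    (hτ : Continuous τ) (hg : Continuous g) {O : Set X} (hO : IsOpen O) {z₀ : Z}
    (h : ∀ s ≤ τ z₀, φ s (g z₀) ∈ O) : ∀ᶠ z in 𝓝 z₀, ∀ s ≤ τ z, φ s (g z) ∈ O := by
  have hc : Continuous fun p : Z × ℝ≥0 => φ (p.2 * τ p.1) (g p.1) := by fun_prop
  have hev : ∀ᶠ z in 𝓝 z₀, ∀ r ∈ Set.Icc (0 : ℝ≥0) 1, φ (r * τ z) (g z) ∈ O := by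
    refine isCompact_Icc.eventually_forall_of_forall_eventually fun r hr => ?_
    exact hc.continuousAt.eventually
      (hO.mem_nhds (h _ (mul_le_of_le_one_left zero_le hr.2)))
  filter_upwards [hev] with z hz s hs
  obtain ⟨r, hr, rfl⟩ := exists_mul_eq_of_le hs
  exact hz r hr

lemma eventually_exists_le_notMem {Z : Type*} [TopologicalSpace Z] {τ : Z → ℝ≥0} {g : Z → X}
    (hτ : Continuous τ) (hg : Continuous g) {C : Set X} (hC : IsClosed C) {z₀ : Z}
    (h : ∃ s ≤ τ z₀, φ s (g z₀) ∉ C) : ∀ᶠ z in 𝓝 z₀, ∃ s ≤ τ z, φ s (g z) ∉ C := by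
  obtain ⟨s, hs, hsC⟩ := h
  obtain ⟨r, hr, rfl⟩ := exists_mul_eq_of_le hs
  have hc : Continuous fun z => φ (r * τ z) (g z) := by fun_prop
  filter_upwards [hc.continuousAt.eventually (hC.isOpen_compl.mem_nhds hsC)] with z hz
  exact ⟨r * τ z, mul_le_of_le_one_left zero_le hr.2, hz⟩

variable {S N L : Set X}

/-- The orbit segment of `x` of length `t` stays in `N \ L`. -/
def StaysIn (φ : Flow ℝ≥0 X) (N L : Set X) (t : ℝ≥0) (x : X) : Prop := ∀ s ≤ t, φ s x ∈ N \ L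

/-- An orbit can leave `N` only after meeting the exit set `L`. -/
lemma IsIndexPair.staysIn (h : IsIndexPair φ S N L) {x : X} {t : ℝ≥0} (hx : x ∈ N)
    (hL : ∀ s ≤ t, φ s x ∉ L) : StaysIn φ N L t x := by
  refine fun s hs => ⟨?_, hL s hs⟩
  by_contra hN
  have hs0 : 0 < s := by
    refine pos_iff_ne_zero.2 ?_
    rintro rfl
    exact hN (by rwa [φ.map_zero_apply])
  obtain ⟨t₀, ht₀, -, hmem⟩ := h.exitSet x hx s hs0 hN
  exact hL t₀ (ht₀.trans hs) hmem

lemma IsIndexPair.mem_of_exists (h : IsIndexPair φ S N L) {x : X} {t : ℝ≥0}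
    (hN : ∀ s ≤ t, φ s x ∈ N) (hL : ∃ s ≤ t, φ s x ∈ L) : φ t x ∈ L := by
  obtain ⟨s, hs, hsL⟩ := hL
  obtain ⟨d, rfl⟩ := exists_add_of_le hs
  have := h.posInvariant _ hsL d (fun r hr => by
    rw [← φ.map_add, add_comm]; exact hN _ (by gcongr)) d le_rfl
  rwa [← φ.map_add, add_comm] at this

variable [T2Space X]

/-- Near each point, either orbit segments stay in `N \ L`, or they do not, or the segment remains
in `N` and ends in `L`. -/
lemma IsIndexPair.trichotomy (h : IsIndexPair φ S N L) {Z : Type*} [TopologicalSpace Z]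
    {τ : Z → ℝ≥0} {g : Z → X} (hτ : Continuous τ) (hg : Continuous g) (z₀ : Z)
    (hN : ∀ᶠ z in 𝓝 z₀, g z ∈ N) :
    (∀ᶠ z in 𝓝 z₀, StaysIn φ N L (τ z) (g z)) ∨
      ((∀ s ≤ τ z₀, φ s (g z₀) ∈ N) ∧ φ (τ z₀) (g z₀) ∈ L) ∨
      ∀ᶠ z in 𝓝 z₀, ¬ StaysIn φ N L (τ z) (g z) := by
  by_cases hout : ∃ s ≤ τ z₀, φ s (g z₀) ∉ N
  · refine Or.inr (Or.inr ?_)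
    filter_upwards [eventually_exists_le_notMem hτ hg h.isCompact_left.isClosed hout]
    rintro z ⟨s, hs, hsN⟩ hst
    exact hsN (hst s hs).1
  · push Not at hout
    by_cases hL : ∃ s ≤ τ z₀, φ s (g z₀) ∈ L
    · exact Or.inr (Or.inl ⟨hout, h.mem_of_exists hout hL⟩)
    · push Not at hL
      refine Or.inl ?_
      filter_upwards [hN, eventually_forall_le_mem hτ hg h.isCompact_right.isClosed.isOpen_compl hL]
        with z hz hz'
      exact h.staysIn hz hz'

/-! ### The induced semiflow on `N / L` -/

open scoped Classical in
/-- The time-`t` map of the semiflow induced on `N / L`. -/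
def quotFlow (φ : Flow ℝ≥0 X) (N L : Set X) (t : ℝ≥0) : PointedQuotient N L → PointedQuotient N L :=
  quotDescend
    (fun y : N => if StaysIn φ N L t y then toQuot N L (φ t y) else basePoint N L)
    (basePoint N L) fun y hy => if_neg fun h => by
      have := (h 0 zero_le).2
      rw [φ.map_zero_apply] at this
      exact this hy

omit [T2Space X] in
open scoped Classical in
lemma quotFlow_toQuot (t : ℝ≥0) {y : X} (hy : y ∈ N) : quotFlow φ N L t (toQuot N L y) =
    if StaysIn φ N L t y then toQuot N L (φ t y) else basePoint N L :=
  quotDescend_toQuot _ _ _ ⟨y, hy⟩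

omit [T2Space X] in
lemma quotFlow_zero (p : PointedQuotient N L) : quotFlow φ N L 0 p = p := by
  rcases pointedQuotient_cases p with rfl | ⟨y, hy, rfl⟩
  · rfl
  · rw [quotFlow_toQuot 0 hy]
    split_ifs with h
    · rw [φ.map_zero_apply]
    · by_contra hne
      refine h fun s hs => ?_
      rw [le_antisymm hs zero_le, φ.map_zero_apply]
      exact ⟨hy, fun hL => hne (toQuot_of_mem hL).symm⟩

/-- The product of the quotient map with the locally compact space `ℝ≥0` is again a quotient map, so
continuity can be checked on `N`. There the trichotomy says that the formula changes only where the
value is in `L`. -/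
lemma IsIndexPair.continuous_quotFlow (h : IsIndexPair φ S N L) :
    Continuous fun p : ℝ≥0 × PointedQuotient N L => quotFlow φ N L p.1 p.2 := by
  classical
  refine (isQuotientMap_quot_mk (r := collapseRel N L)).continuous_lift_prod_right
    (g := fun p : ℝ≥0 × PointedQuotient N L => quotFlow φ N L p.1 p.2) ?_
  rw [← (Homeomorph.prodSumDistrib (X := ℝ≥0) (Y := N) (Z := PUnit.{u + 1})).symm.comp_continuous_iff',
    continuous_sum_dom]
  refine ⟨?_, continuous_const⟩
  change Continuous fun p : ℝ≥0 × N =>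
    if StaysIn φ N L p.1 p.2 then toQuot N L (φ p.1 p.2) else basePoint N L
  refine continuous_ite_toQuot (by fun_prop) (fun p hp => (hp p.1 le_rfl).1) h.subset fun p => ?_
  rcases h.trichotomy (Z := ℝ≥0 × N) (τ := Prod.fst) (g := fun p => (p.2 : X)) continuous_fst
    (by fun_prop) p (.of_forall fun p => p.2.2) with h₁ | h₁ | h₁
  exacts [Or.inl h₁, Or.inr (Or.inl h₁.2), Or.inr (Or.inr h₁)]

/-! ### Comparison of index pairs -/

/-- Orbit segments of length `2T` in `N \ L` have their midpoint in `N' \ L'`. -/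
def Squeezes (φ : Flow ℝ≥0 X) (N L N' L' : Set X) (T : ℝ≥0) : Prop :=
  ∀ y, StaysIn φ N L (2 * T) y → φ T y ∈ N' \ L'

/-- The condition under which the comparison map is given by the semiflow. -/
def ComparisonDomain (φ : Flow ℝ≥0 X) (N L N' L' : Set X) (T : ℝ≥0) (y : X) : Prop :=
  StaysIn φ N L (2 * T) y ∧ StaysIn φ N' L' (2 * T) (φ T y)

open scoped Classical in
/-- The comparison map between the pointed quotients of two index pairs. -/
def comparison (φ : Flow ℝ≥0 X) (N L N' L' : Set X) (T : ℝ≥0) :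
    PointedQuotient N L → PointedQuotient N' L' :=
  quotDescend
    (fun y : N => if ComparisonDomain φ N L N' L' T y
      then toQuot N' L' (φ (2 * T) (φ T y)) else basePoint N' L')
    (basePoint N' L') fun y hy => if_neg fun h => by
      have := (h.1 0 zero_le).2
      rw [φ.map_zero_apply] at this
      exact this hy

omit [T2Space X] in
open scoped Classical in
lemma comparison_toQuot {N' L' : Set X} (T : ℝ≥0) {y : X} (hy : y ∈ N) :
    comparison φ N L N' L' T (toQuot N L y) =
      if ComparisonDomain φ N L N' L' T y
        then toQuot N' L' (φ (2 * T) (φ T y)) else basePoint N' L' :=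
  quotDescend_toQuot _ _ _ ⟨y, hy⟩

lemma continuous_comparison {N' L' : Set X} (h : IsIndexPair φ S N L) (h' : IsIndexPair φ S N' L')
    {T : ℝ≥0} (hT : Squeezes φ N L N' L' T) (hT' : Squeezes φ N' L' N L T) :
    Continuous (comparison φ N L N' L' T) := by
  classical
  refine continuous_quotDescend ?_ _ _
  refine continuous_ite_toQuot (by fun_prop) (fun y hy => (hy.2 _ le_rfl).1) h'.subset fun y => ?_
  have hg : Continuous fun y : N => φ T y := by fun_prop
  rcases h.trichotomy (τ := fun _ => 2 * T) (g := fun y : N => (y : X)) continuous_const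
    continuous_subtype_val y (.of_forall Subtype.prop) with h₁ | ⟨h₁, h₂⟩ | h₁
  · rcases h'.trichotomy (τ := fun _ => 2 * T) (g := fun y : N => φ T y) continuous_const
      hg y (h₁.mono fun z hz => (hT z hz).1) with h₂ | h₂ | h₂
    · exact Or.inl (h₁.and h₂)
    · exact Or.inr (Or.inl h₂.2)
    · exact Or.inr (Or.inr (h₂.mono fun z hz hz' => hz hz'.2))
  · by_cases hout : ∃ s ≤ 2 * T, φ s (φ T y) ∉ N'
    · refine Or.inr (Or.inr ?_)
      filter_upwards [eventually_exists_le_notMem (τ := fun _ => 2 * T) continuous_const hg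
        h'.isCompact_left.isClosed hout]
      rintro z ⟨s, hs, hsN⟩ hst
      exact hsN (hst.2 s hs).1
    · push Not at hout
      by_cases hL : ∃ s ≤ 2 * T, φ s (φ T y) ∈ L'
      · exact Or.inr (Or.inl (h'.mem_of_exists hout hL))
      · push Not at hL
        -- The delicate case: the first segment ends in `L` while the second stays in `N' \ L'`.
        -- Squeezing in the opposite direction puts the midpoint of the second segment, which is the
        -- end of the first, into `N \ L`.
        refine absurd h₂ ?_
        have := hT' (φ T y) fun s hs => ⟨hout s hs, hL s hs⟩
        rw [← φ.map_add, ← two_mul] at this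
        exact this.2
  · exact Or.inr (Or.inr (h₁.mono fun z hz hz' => hz hz'.1))

omit [T2Space X] in
lemma staysIn_add {t t' : ℝ≥0} {y : X} :
    StaysIn φ N L (t + t') y ↔ StaysIn φ N L t y ∧ StaysIn φ N L t' (φ t y) := by
  constructor
  · refine fun h => ⟨fun s hs => h s (hs.trans le_self_add), fun s hs => ?_⟩
    rw [← φ.map_add]
    exact h _ (by rw [add_comm]; gcongr)
  · rintro ⟨h₁, h₂⟩ s hs
    rcases le_total s t with hst | hst
    · exact h₁ s hst
    · obtain ⟨d, rfl⟩ := exists_add_of_le hst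
      rw [add_comm, φ.map_add]
      exact h₂ d (le_of_add_le_add_left hs)

omit [T2Space X] in
lemma Squeezes.staysIn {N' L' : Set X} {T t : ℝ≥0} (hT : Squeezes φ N L N' L' T) {y : X}
    (h : StaysIn φ N L (2 * T + t) y) : StaysIn φ N' L' t (φ T y) := by
  intro s hs
  rw [← φ.map_add, add_comm, φ.map_add]
  refine hT _ fun r hr => ?_
  rw [← φ.map_add]
  exact h _ (add_le_add hr hs)

omit [T2Space X] in
-- The composite requires the orbit to be in `N \ L` during $[0,2T]$ and $[4T,6T]$, and in `N' \ L'`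
-- during $[T,5T]$. Squeezing the latter gives `N \ L` during the missing interval $[2T,4T]$.
-- Conversely, squeezing $[0,6T]$ gives $[T,5T]$.
lemma comparisonDomain_iff {N' L' : Set X} {T : ℝ≥0} (hT : Squeezes φ N L N' L' T)
    (hT' : Squeezes φ N' L' N L T) (y : X) :
    (ComparisonDomain φ N L N' L' T y ∧ ComparisonDomain φ N' L' N L T (φ (2 * T) (φ T y))) ↔
      StaysIn φ N L (6 * T) y := by
  have h₁ : 6 * T = (2 * T + 2 * T) + 2 * T := by ring
  have h₂ : 2 * T = T + T := by ring
  have h₃ : φ (2 * T + 2 * T) y = φ T (φ (2 * T) (φ T y)) := by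
    rw [← φ.map_add, ← φ.map_add]
    congr 1
    ring
  constructor
  · rintro ⟨⟨ha, hb⟩, hc, hd⟩
    rw [h₁, staysIn_add, staysIn_add, h₃]
    refine ⟨⟨ha, ?_⟩, hd⟩
    have := hT'.staysIn (staysIn_add.2 ⟨hb, hc⟩)
    rwa [← φ.map_add, ← h₂] at this
  · intro h
    have hβ : StaysIn φ N' L' (2 * T + 2 * T) (φ T y) := by
      refine hT.staysIn ?_
      rwa [show 2 * T + (2 * T + 2 * T) = 6 * T by ring]
    rw [h₁, staysIn_add, staysIn_add, h₃] at h
    rw [staysIn_add] at hβ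
    exact ⟨⟨h.1.1, hβ.1⟩, hβ.2, h.2⟩

omit [T2Space X] in
lemma comparison_comparison {N' L' : Set X} {T : ℝ≥0} (hT : Squeezes φ N L N' L' T)
    (hT' : Squeezes φ N' L' N L T) (p : PointedQuotient N L) :
    comparison φ N' L' N L T (comparison φ N L N' L' T p) = quotFlow φ N L (6 * T) p := by
  rcases pointedQuotient_cases p with rfl | ⟨y, hy, rfl⟩
  · rfl
  have h6 : φ (2 * T) (φ T (φ (2 * T) (φ T y))) = φ (6 * T) y := by
    rw [← φ.map_add, ← φ.map_add, ← φ.map_add]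
    congr 1
    ring
  have hiff := comparisonDomain_iff hT hT' y
  rw [comparison_toQuot T hy, quotFlow_toQuot _ hy]
  by_cases h₁ : ComparisonDomain φ N L N' L' T y
  · rw [if_pos h₁, comparison_toQuot T (h₁.2 _ le_rfl).1]
    by_cases h₂ : ComparisonDomain φ N' L' N L T (φ (2 * T) (φ T y))
    · rw [if_pos h₂, if_pos (hiff.1 ⟨h₁, h₂⟩), h6]
    · rw [if_neg h₂, if_neg fun h => h₂ (hiff.2 h).2]
  · rw [if_neg h₁, if_neg fun h => h₁ (hiff.2 h).1]
    rfl

end Orbits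

/-! ### Invariance of the homology of `N / L` -/

/-- The homotopy along a family of maps parametrized by `[0, T]`. -/
def homotopyOfFamily {Y Z : TopCat.{u}} {f g : Y ⟶ Z} (H : ℝ≥0 × Y → Z) (hH : Continuous H)
    (T : ℝ≥0) (h₀ : ∀ y, H (0, y) = f y) (h₁ : ∀ y, H (T, y) = g y) : TopCat.Homotopy f g where
  toFun p := H (Real.toNNReal (p.1 : ℝ) * T, p.2)
  continuous_toFun := by fun_prop
  map_zero_left y := by simpa using h₀ y
  map_one_left y := by simpa using h₁ y

/-- The homotopy between equal maps. -/
def homotopyOfEq {Y Z : TopCat.{u}} {f g : Y ⟶ Z} (h : ∀ y, f y = g y) : TopCat.Homotopy f g :=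
  homotopyOfFamily (fun p => f p.2) (by fun_prop) 0 (fun _ => rfl) h

section

variable {X : Type u} [TopologicalSpace X] [T2Space X] {φ : Flow ℝ≥0 X} {S N L N' L' : Set X}

/-- The two comparison maps are homotopy inverse, the homotopies being the induced semiflows up to
time `6 * T`. The base points are compared separately, and the long exact sequence passes to
relative chains. -/
lemma nonempty_quotientHomology_equiv (h : IsIndexPair φ S N L) (h' : IsIndexPair φ S N' L')
    {T : ℝ≥0} (hT : Squeezes φ N L N' L' T) (hT' : Squeezes φ N' L' N L T) (i : ℕ) :
    Nonempty (quotientHomology N L i ≃ₗ[ℤ] quotientHomology N' L' i) := by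
  let f : C(PointedQuotient N L, PointedQuotient N' L') :=
    ⟨comparison φ N L N' L' T, continuous_comparison h h' hT hT'⟩
  let g : C(PointedQuotient N' L', PointedQuotient N L) :=
    ⟨comparison φ N' L' N L T, continuous_comparison h' h hT' hT⟩
  have hf : Set.MapsTo f {basePoint N L} {basePoint N' L'} := by rintro _ rfl; rfl
  have hg : Set.MapsTo g {basePoint N' L'} {basePoint N L} := by rintro _ rfl; rfl
  have h₁ : QuasiIso (singularChainsMap (restrictMap f hf)) :=
    quasiIso_singularChainsMap _ (restrictMap g hg)
      (homotopyOfEq fun y => Subtype.ext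
        (((restrictMap f hf ≫ restrictMap g hg) y).2.trans y.2.symm))
      (homotopyOfEq fun y => Subtype.ext
        (((restrictMap g hg ≫ restrictMap f hf) y).2.trans y.2.symm))
  have h₂ : QuasiIso (singularChainsMap (TopCat.ofHom f)) :=
    quasiIso_singularChainsMap _ (TopCat.ofHom g)
      (homotopyOfFamily (fun p => quotFlow φ N L p.1 p.2) h.continuous_quotFlow (6 * T)
        quotFlow_zero fun p => (comparison_comparison hT hT' p).symm).symm
      (homotopyOfFamily (fun p => quotFlow φ N' L' p.1 p.2) h'.continuous_quotFlow (6 * T)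
        quotFlow_zero fun p => (comparison_comparison hT' hT p).symm).symm
  have := quasiIso_relChainsMap f hf h₁ h₂
  exact nonempty_relHomology_equiv (relChainsMap f hf) i

/-- Orbit segments of sufficiently large length in a closed set `K` have their midpoint close to
the maximal invariant subset of `K`. -/
lemma exists_squeeze [CompactSpace X] {K O : Set X} (hK : IsClosed K)
    (hO : O ∈ 𝓝ˢ (maxInv φ K)) :
    ∃ T₀ : ℝ≥0, ∀ T ≥ T₀, ∀ y, (∀ s ≤ 2 * T, φ s y ∈ K) → φ T y ∈ O := by
  suffices ∃ n : ℕ, ∀ y, (∀ s ≤ 2 * (n : ℝ≥0), φ s y ∈ K) → φ n y ∈ O by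
    obtain ⟨n, hn⟩ := this
    refine ⟨n, fun T hT y hy => ?_⟩
    obtain ⟨d, rfl⟩ := exists_add_of_le hT
    rw [φ.map_add]
    refine hn _ fun s hs => ?_
    rw [← φ.map_add]
    refine hy _ ?_
    calc s + d ≤ 2 * n + 2 * d := add_le_add hs (by rw [two_mul]; exact le_self_add)
      _ = 2 * (n + d) := by ring
  by_contra! hcon
  choose y hyK hyO using hcon
  -- Counterexamples for every `n` are recentred at their midpoints. By compactness they converge
  -- along a nonprincipal ultrafilter, at each real time, to a complete orbit `γ` in `K`. Its range
  -- is invariant, so `γ 0` lies in `maxInv φ K`, while the midpoints avoid `O`.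
  let 𝒰 := Filter.hyperfilter ℕ
  let γ : ℝ → X := fun r => (𝒰.map fun n : ℕ => φ (Real.toNNReal (n + r)) (y n)).lim
  have hγ : ∀ r, Filter.Tendsto (fun n : ℕ => φ (Real.toNNReal (n + r)) (y n)) 𝒰 (𝓝 (γ r)) :=
    fun r => Ultrafilter.le_nhds_lim _
  have hle : (𝒰 : Filter ℕ) ≤ Filter.atTop := Nat.hyperfilter_le_atTop
  have hlarge : ∀ r : ℝ, ∀ᶠ n : ℕ in (𝒰 : Filter ℕ), r ≤ n := fun r =>
    hle (tendsto_natCast_atTop_atTop.eventually_ge_atTop r)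
  have hflow : ∀ (t : ℝ≥0) r, φ t (γ r) = γ (r + t) := fun t r => by
    refine tendsto_nhds_unique (((φ.continuous_toFun t).tendsto _).comp (hγ r))
      ((hγ (r + t)).congr' ?_)
    -- For negative `r`, this makes `n + r` nonnegative, so that `Real.toNNReal` does not truncate.
    filter_upwards [hlarge (-r)] with n hn
    change _ = φ t _
    rw [← φ.map_add]
    congr 1
    rw [← add_assoc, Real.toNNReal_add (by linarith) t.coe_nonneg, add_comm, Real.toNNReal_coe]
  have hmemK : ∀ r, γ r ∈ K := fun r => by
    refine hK.mem_of_tendsto (hγ r) ?_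
    filter_upwards [hlarge r] with n hn
    refine hyK n _ (Real.toNNReal_le_iff_le_coe.2 ?_)
    push_cast
    linarith
  have hinv : IsInvariantSet φ (Set.range γ) := fun t => by
    refine Set.Subset.antisymm ?_ ?_
    · rintro _ ⟨_, ⟨r, rfl⟩, rfl⟩
      exact ⟨r + t, (hflow t r).symm⟩
    · rintro _ ⟨r, rfl⟩
      -- Backward times of the complete orbit give the inclusion that mere positive invariance would
      -- not.
      exact ⟨γ (r - t), ⟨_, rfl⟩, by rw [hflow, sub_add_cancel]⟩
  have hγ0 : γ 0 ∈ maxInv φ K :=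
    ⟨Set.range γ, ⟨by rintro _ ⟨r, rfl⟩; exact hmemK r, hinv⟩, 0, rfl⟩
  have hev := (hγ 0).eventually (mem_nhdsSet_iff_forall.1 hO _ hγ0)
  obtain ⟨n, hn⟩ := hev.exists
  refine hyO n ?_
  change φ (Real.toNNReal (n + 0)) (y n) ∈ O at hn
  simpa using hn

lemma IsIndexPair.exists_squeezes [CompactSpace X] (h : IsIndexPair φ S N L)
    (h' : IsIndexPair φ S N' L') :
    ∃ T, Squeezes φ N L N' L' T ∧ Squeezes φ N' L' N L T := by
  obtain ⟨T₁, hT₁⟩ := exists_squeeze (φ := φ) (K := closure (N \ L)) (O := N' \ L')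
    isClosed_closure (h.eq_maxInv ▸ h'.mem_nhdsSet)
  obtain ⟨T₂, hT₂⟩ := exists_squeeze (φ := φ) (K := closure (N' \ L')) (O := N \ L)
    isClosed_closure (h'.eq_maxInv ▸ h.mem_nhdsSet)
  exact ⟨max T₁ T₂,
    fun y hy => hT₁ _ (le_max_left _ _) y fun s hs => subset_closure (hy s hs),
    fun y hy => hT₂ _ (le_max_right _ _) y fun s hs => subset_closure (hy s hs)⟩

/-- The Conley index does not depend on the good index pair. -/
lemma IsGoodIndexPair.nonempty_pairHomology_equiv [CompactSpace X] (h : IsGoodIndexPair φ S N L)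
    (h' : IsGoodIndexPair φ S N' L') (i : ℕ) :
    Nonempty (pairHomology N L i ≃ₗ[ℤ] pairHomology N' L' i) := by
  obtain ⟨T, hT, hT'⟩ := h.toIsIndexPair.exists_squeezes h'.toIsIndexPair
  obtain ⟨e⟩ := nonempty_quotientHomology_equiv h.toIsIndexPair h'.toIsIndexPair hT hT' i
  obtain ⟨e₁⟩ := h.good i
  obtain ⟨e₂⟩ := h'.good i
  exact ⟨(e₁.trans e).trans e₂.symm⟩

end

/-! ### Good index pairs -/

section Good

variable {X : Type u} [TopologicalSpace X] {N L : Set X}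

/-- The subset of `N / L` given by a subset of `X` that contains `L`. -/
def quotSet (N : Set X) {L U : Set X} (hLU : L ⊆ U) : Set (PointedQuotient N L) :=
  {p | quotDescend (fun y : N => (y : X) ∈ U) True (fun _ hy => eq_true (hLU hy)) p}

/-- The subset of `N / L` given by a subset of `X` disjoint from `L`. -/
def quotSet' (N : Set X) {L V : Set X} (hLV : Disjoint L V) : Set (PointedQuotient N L) :=
  {p | quotDescend (fun y : N => (y : X) ∈ V) False
    (fun _ hy => eq_false (Set.disjoint_left.1 hLV hy)) p}

omit [TopologicalSpace X] in
lemma basePoint_mem_quotSet {U : Set X} (hLU : L ⊆ U) : basePoint N L ∈ quotSet N hLU := trivial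

omit [TopologicalSpace X] in
lemma toQuot_mem_quotSet {U : Set X} (hLU : L ⊆ U) {y : X} (hy : y ∈ N) :
    toQuot N L y ∈ quotSet N hLU ↔ y ∈ U :=
  iff_of_eq (quotDescend_toQuot _ _ (fun _ hy => eq_true (hLU hy)) ⟨y, hy⟩)

omit [TopologicalSpace X] in
lemma toQuot_mem_quotSet' {V : Set X} (hLV : Disjoint L V) {y : X} (hy : y ∈ N) :
    toQuot N L y ∈ quotSet' N hLV ↔ y ∈ V :=
  iff_of_eq (quotDescend_toQuot _ _ (fun _ hy => eq_false (Set.disjoint_left.1 hLV hy)) ⟨y, hy⟩)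

lemma isOpen_quotSet {U : Set X} (hLU : L ⊆ U) (hU : IsOpen U) : IsOpen (quotSet N hLU) := by
  refine (isQuotientMap_quot_mk (r := collapseRel N L)).isOpen_preimage.1 ?_
  exact isOpen_sum_iff.2 ⟨hU.preimage continuous_subtype_val, isOpen_univ⟩

lemma isOpen_quotSet' {V : Set X} (hLV : Disjoint L V) (hV : IsOpen V) :
    IsOpen (quotSet' N hLV) := by
  refine (isQuotientMap_quot_mk (r := collapseRel N L)).isOpen_preimage.1 ?_
  exact isOpen_sum_iff.2 ⟨hV.preimage continuous_subtype_val, isOpen_empty⟩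

omit [TopologicalSpace X] in
lemma toQuot_injOn : Set.InjOn (toQuot N L) (N \ L) := by
  classical
  intro y hy y' hy' h
  have h' := congrArg (quotDescend (fun y : N => if (y : X) ∈ L then none else some (y : X)) none
    fun _ hy => if_pos hy) h
  have e : ∀ z : N, quotDescend (fun y : N => if (y : X) ∈ L then none else some (y : X)) none
    (fun _ hy => if_pos hy) (toQuot N L z) = if (z : X) ∈ L then none else some (z : X) :=
    quotDescend_toQuot _ _ _
  rw [e ⟨y, hy.1⟩, e ⟨y', hy'.1⟩] at h'
  simpa [hy.2, hy'.2] using h'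

/-- Away from the base point, `N / L` is homeomorphic to `N \ L`. -/
lemma isOpenEmbedding_toQuot (hL : IsClosed L) :
    Topology.IsOpenEmbedding fun y : {y : N // (y : X) ∉ L} => toQuot N L y := by
  refine .of_continuous_injective_isOpenMap (continuous_toQuot_coe.comp continuous_subtype_val)
    (fun y y' h => Subtype.ext (Subtype.ext (toQuot_injOn ⟨y.1.2, y.2⟩ ⟨y'.1.2, y'.2⟩ h))) ?_
  intro O hO
  obtain ⟨O', hO', rfl⟩ := isOpen_induced_iff.1 hO
  obtain ⟨O'', hO'', rfl⟩ := isOpen_induced_iff.1 hO'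
  have hdisj : Disjoint L (O'' \ L) := Set.disjoint_sdiff_right
  convert isOpen_quotSet' (N := N) hdisj (hO''.sdiff hL)
  ext p
  constructor
  · rintro ⟨y, hy, rfl⟩
    exact (toQuot_mem_quotSet' hdisj y.1.2).2 ⟨hy, y.2⟩
  · intro hp
    rcases pointedQuotient_cases p with rfl | ⟨y, hy, rfl⟩
    · exact hp.elim
    · have := (toQuot_mem_quotSet' hdisj hy).1 hp
      exact ⟨⟨⟨y, hy⟩, this.2⟩, this.1, rfl⟩

/-- Collapsing the closed set `L` is an isomorphism on homology relative to an open set `U` that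
contains `L`. -/
lemma quasiIso_collapse (hL : IsClosed L) {U : Set X} (hLU : L ⊆ U) (hU : IsOpen U) :
    QuasiIso (relChainsMap (⟨fun y : N => toQuot N L y, continuous_toQuot_coe⟩ : C(N, _))
      (Set.mapsTo_preimage _ (quotSet N hLU))) := by
  have hdisj : Disjoint L Lᶜ := disjoint_compl_right
  refine quasiIso_excision _ (isOpen_quotSet hLU hU)
    (isOpen_quotSet' (N := N) hdisj hL.isOpen_compl) ?_ ?_ ?_
  · refine Set.eq_univ_of_forall fun p => ?_
    rcases pointedQuotient_cases p with rfl | ⟨y, hy, rfl⟩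
    · exact Or.inl (basePoint_mem_quotSet hLU)
    · by_cases hyL : y ∈ L
      · exact Or.inl ((toQuot_mem_quotSet hLU hy).2 (hLU hyL))
      · exact Or.inr ((toQuot_mem_quotSet' hdisj hy).2 hyL)
  · intro y hy y' hy' h
    exact Subtype.ext (toQuot_injOn ⟨y.2, (toQuot_mem_quotSet' hdisj y.2).1 hy⟩
      ⟨y'.2, (toQuot_mem_quotSet' hdisj y'.2).1 hy'⟩ h)
  · intro n σ' hσ'
    have hex : ∀ t, ∃ y : {y : N // (y : X) ∉ L}, toQuot N L y = σ' t := fun t => by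
      have ht := hσ' ⟨t, rfl⟩
      rcases pointedQuotient_cases (σ' t) with hp | ⟨y, hy, hp⟩
      · rw [hp] at ht
        exact ht.elim
      · rw [hp] at ht
        exact ⟨⟨⟨y, hy⟩, (toQuot_mem_quotSet' hdisj hy).1 ht⟩, hp.symm⟩
    choose y hy using hex
    have hcont : Continuous y := by
      rw [(isOpenEmbedding_toQuot (N := N) hL).isInducing.continuous_iff]
      convert σ'.continuous using 1
      exact funext hy
    refine ⟨⟨fun t => (y t).1, by fun_prop⟩, ?_⟩
    ext t
    exact hy t

/-- Homology relative to `B` agrees with homology relative to `B'` if a homotopy of the identity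
that preserves `B` and `B'` moves `B'` into `B`. -/
lemma quasiIso_relChainsMap_id {Y : Type u} [TopologicalSpace Y] {B B' : Set Y}
    (hBB' : Set.MapsTo (ContinuousMap.id Y) B B') (H : ℝ≥0 × Y → Y) (hH : Continuous H)
    (h₀ : ∀ y, H (0, y) = y) (hB : ∀ t, ∀ y ∈ B, H (t, y) ∈ B)
    (hB' : ∀ t, ∀ y ∈ B', H (t, y) ∈ B') {T : ℝ≥0} (hT : ∀ y ∈ B', H (T, y) ∈ B) :
    QuasiIso (relChainsMap (ContinuousMap.id Y) hBB') := by
  let ψ : TopCat.of B' ⟶ TopCat.of B := TopCat.ofHom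
    ⟨fun y => ⟨H (T, y), hT y y.2⟩, by fun_prop⟩
  refine quasiIso_relChainsMap _ _ (quasiIso_singularChainsMap _ ψ ?_ ?_)
    (quasiIso_singularChainsMap _ (𝟙 _) (homotopyOfEq fun _ => rfl) (homotopyOfEq fun _ => rfl))
  · have hc : Continuous fun p : ℝ≥0 × B => (⟨H (p.1, p.2), hB _ _ p.2.2⟩ : B) := by fun_prop
    exact (homotopyOfFamily (Y := TopCat.of B) (Z := TopCat.of B) _ hc T
      (fun y => Subtype.ext (h₀ _)) fun y => Subtype.ext rfl).symm
  · have hc : Continuous fun p : ℝ≥0 × B' => (⟨H (p.1, p.2), hB' _ _ p.2.2⟩ : B') := by fun_prop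
    exact (homotopyOfFamily (Y := TopCat.of B') (Z := TopCat.of B') _ hc T
      (fun y => Subtype.ext (h₀ _)) fun y => Subtype.ext rfl).symm

variable [T2Space X] {φ : Flow ℝ≥0 X} {S : Set X}

/-- An index pair of positively invariant sets is good if its second member has a positively
invariant open neighbourhood that flows into it in finite time. -/
lemma IsIndexPair.isGoodIndexPair (h : IsIndexPair φ S N L) {U : Set X} (hU : IsOpen U)
    (hLU : L ⊆ U) (hN : ∀ t, Set.MapsTo (φ t) N N) (hLinv : ∀ t, Set.MapsTo (φ t) L L)
    (hUinv : ∀ t, Set.MapsTo (φ t) U U) {T : ℝ≥0} (hT : Set.MapsTo (φ T) U L) :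
    IsGoodIndexPair φ S N L := by
  refine { h with good := fun i => ?_ }
  let BL : Set N := {y : N | (y : X) ∈ L}
  let BU : Set N := {y : N | (y : X) ∈ U}
  let U' := quotSet N hLU
  have hLU' : Set.MapsTo (ContinuousMap.id N) BL BU := fun y hy => hLU hy
  have hbase : Set.MapsTo (ContinuousMap.id (PointedQuotient N L)) {basePoint N L} U' := by
    rintro _ rfl
    exact basePoint_mem_quotSet hLU
  -- The chain is $H(N,L)\cong H(N,N\cap U)\cong H(N/L,U')\cong H(N/L,*)$. The outer steps push
  -- along the semiflow, in `N` and in `N / L`; the middle one is excision.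
  have q₁ : QuasiIso (relChainsMap (ContinuousMap.id N) hLU') :=
    quasiIso_relChainsMap_id hLU' (fun p => ⟨φ p.1 p.2, hN _ p.2.2⟩) (by fun_prop)
      (fun y => Subtype.ext (φ.map_zero_apply _)) (fun t y hy => hLinv t hy)
      (fun t y hy => hUinv t hy) (T := T) fun y hy => hT hy
  have q₂ := quasiIso_collapse (N := N) h.isCompact_right.isClosed hLU hU
  have q₃ : QuasiIso (relChainsMap (ContinuousMap.id (PointedQuotient N L)) hbase) := by
    have hflow : ∀ t p, p ∈ U' → quotFlow φ N L t p ∈ U' := fun t p hp => by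
      classical
      rcases pointedQuotient_cases p with rfl | ⟨y, hy, rfl⟩
      · exact hp
      · rw [quotFlow_toQuot t hy]
        split_ifs
        · exact (toQuot_mem_quotSet hLU (hN t hy)).2
            (hUinv t ((toQuot_mem_quotSet hLU hy).1 hp))
        · exact basePoint_mem_quotSet hLU
    have hflowT : ∀ p ∈ U', quotFlow φ N L T p = basePoint N L := fun p hp => by
      classical
      rcases pointedQuotient_cases p with rfl | ⟨y, hy, rfl⟩
      · rfl
      · rw [quotFlow_toQuot T hy, if_neg]
        exact fun hst => (hst T le_rfl).2 (hT ((toQuot_mem_quotSet hLU hy).1 hp))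
    exact quasiIso_relChainsMap_id hbase (fun p => quotFlow φ N L p.1 p.2) h.continuous_quotFlow
      quotFlow_zero (by rintro t _ rfl; rfl) hflow hflowT
  have hBU : (fun y : N => toQuot N L y) ⁻¹' U' = BU :=
    Set.ext fun y => toQuot_mem_quotSet hLU y.2
  obtain ⟨e₁⟩ := nonempty_relHomology_equiv (relChainsMap (ContinuousMap.id N) hLU') i
  obtain ⟨e₂⟩ := nonempty_relHomology_equiv
    (relChainsMap (⟨fun y : N => toQuot N L y, continuous_toQuot_coe⟩ : C(N, _))
      (Set.mapsTo_preimage _ U')) i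
  obtain ⟨e₃⟩ := nonempty_relHomology_equiv
    (relChainsMap (ContinuousMap.id (PointedQuotient N L)) hbase) i
  rw [← hBU] at e₁
  exact ⟨(e₁.trans e₂).trans e₃.symm⟩

end Good

/-! ### Isolating blocks of attractors -/

section Blocks

variable {X : Type u} [TopologicalSpace X] {φ : Flow ℝ≥0 X} {A : Set X}

lemma isInvariantSet_maxInv (K : Set X) : IsInvariantSet φ (maxInv φ K) := by
  intro t
  ext x
  constructor
  · rintro ⟨y, ⟨S, hS, hy⟩, rfl⟩
    exact ⟨S, hS, hS.2 t ▸ ⟨y, hy, rfl⟩⟩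
  · rintro ⟨S, hS, hx⟩
    rw [← hS.2 t] at hx
    obtain ⟨y, hy, rfl⟩ := hx
    exact ⟨y, ⟨S, hS, hy⟩, rfl⟩

lemma subset_maxInv {S K : Set X} (hSK : S ⊆ K) (hS : IsInvariantSet φ S) : S ⊆ maxInv φ K :=
  Set.subset_sUnion_of_mem (show S ∈ {S | S ⊆ K ∧ IsInvariantSet φ S} from ⟨hSK, hS⟩)

lemma maxInv_subset (K : Set X) : maxInv φ K ⊆ K :=
  Set.sUnion_subset fun _ hS => hS.1

lemma IsInvariantSet.subset_omegaLimit {S U : Set X} (hS : IsInvariantSet φ S) (hSU : S ⊆ U) :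
    S ⊆ omegaLimit Filter.atTop φ U := by
  refine Set.subset_iInter₂ fun u hu => ?_
  obtain ⟨t, ht⟩ := Filter.mem_atTop_sets.1 hu
  intro x hx
  rw [← hS t] at hx
  obtain ⟨y, hy, rfl⟩ := hx
  exact subset_closure ⟨t, ht t le_rfl, y, hSU hy, rfl⟩

lemma mapsTo_closure_image2_Ici (T : ℝ≥0) (U : Set X) (t : ℝ≥0) :
    Set.MapsTo (φ t) (closure (Set.image2 φ (Set.Ici T) U))
      (closure (Set.image2 φ (Set.Ici T) U)) := by
  refine Set.MapsTo.closure ?_ (φ.continuous_toFun t)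
  rintro _ ⟨s, hs, x, hx, rfl⟩
  refine ⟨t + s, ?_, x, hx, φ.map_add _ _ _⟩
  exact (show T ≤ s from hs).trans le_add_self

/-- Points whose orbit segment of length `T` lies in `D`. -/
lemma isOpen_setOf_forall_le {D : Set X} (hD : IsOpen D) (T : ℝ≥0) :
    IsOpen {x | ∀ s ≤ T, φ s x ∈ D} :=
  isOpen_iff_mem_nhds.2 fun _ hx =>
    eventually_forall_le_mem (τ := fun _ : X => T) (g := id) continuous_const continuous_id hD hx

lemma isClosed_setOf_forall_le {D : Set X} (hD : IsClosed D) (T : ℝ≥0) :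
    IsClosed {x | ∀ s ≤ T, φ s x ∈ D} := by
  simp only [Set.ofPred_forall]
  exact isClosed_iInter fun s => isClosed_iInter fun _ => hD.preimage (φ.continuous_toFun s)

/-- From time `T` on, the orbit is in `K ⊆ D` anyway, so remaining in `D` up to time `T` already
means remaining there forever. -/
lemma mapsTo_setOf_forall_le {D K U₀ : Set X} {T : ℝ≥0} (hDU : D ⊆ U₀) (hKD : K ⊆ D)
    (hK : ∀ x ∈ U₀, ∀ s ≥ T, φ s x ∈ K) (t : ℝ≥0) :
    Set.MapsTo (φ t) {x | ∀ s ≤ T, φ s x ∈ D} {x | ∀ s ≤ T, φ s x ∈ D} := by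
  intro x hx s _
  rw [← φ.map_add]
  rcases le_total (s + t) T with h | h
  · exact hx _ h
  · have h0 := hx 0 zero_le
    rw [φ.map_zero_apply] at h0
    exact hKD (hK x (hDU h0) _ h)

/-- An attractor has a positively invariant closed neighbourhood `L` and a positively invariant open
neighbourhood `U` of `L` that flows into `L` in finite time and whose orbits tend to the
attractor. -/
lemma IsAttractor.exists_block [CompactSpace X] [NormalSpace X] (hA : IsAttractor φ A) :
    ∃ (U L : Set X) (T : ℝ≥0), IsOpen U ∧ IsClosed L ∧ L ⊆ U ∧ A ⊆ interior L ∧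
      (∀ t, Set.MapsTo (φ t) U U) ∧ (∀ t, Set.MapsTo (φ t) L L) ∧ Set.MapsTo (φ T) U L ∧
      omegaLimit Filter.atTop φ U ⊆ A := by
  obtain ⟨U₀, hU₀, rfl⟩ := hA
  have hAD : omegaLimit Filter.atTop φ U₀ ⊆ interior U₀ := subset_interior_iff_mem_nhdsSet.2 hU₀
  obtain ⟨u, hu, huD⟩ := eventually_closure_subset_of_isOpen_of_omegaLimit_subset
    Filter.atTop φ U₀ isOpen_interior hAD
  obtain ⟨T, hT⟩ := Filter.mem_atTop_sets.1 hu
  have hTu : Set.Ici T ⊆ u := hT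
  set K := closure (Set.image2 φ (Set.Ici T) U₀) with hKdef
  have hKD : K ⊆ interior U₀ := (closure_mono (Set.image2_subset_right hTu)).trans huD
  have hAK : omegaLimit Filter.atTop φ U₀ ⊆ K := Set.iInter₂_subset _ (Filter.Ici_mem_atTop T)
  have hK : ∀ x ∈ U₀, ∀ s ≥ T, φ s x ∈ K := fun x hx s hs => subset_closure ⟨s, hs, x, hx, rfl⟩
  have hKinv : ∀ t, Set.MapsTo (φ t) K K := mapsTo_closure_image2_Ici T U₀
  have hKU : ∀ {D : Set X}, K ⊆ D → K ⊆ {x | ∀ s ≤ T, φ s x ∈ D} := by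
    intro D hD x hx s _
    exact hD (hKinv s hx)
  have hzero : ∀ {D : Set X}, {x | ∀ s ≤ T, φ s x ∈ D} ⊆ D := by
    intro D x hx
    have h0 := hx 0 zero_le
    rwa [φ.map_zero_apply] at h0
  have hUopen := isOpen_setOf_forall_le (φ := φ) (isOpen_interior (s := U₀)) T
  -- Normality leaves room between the absorbing closed set `K` and the open block. The closed block
  -- is built from `closure V` just as the open one is built from `interior U₀`.
  obtain ⟨V, hV, hKV, hVU⟩ := normal_exists_closure_subset isClosed_closure hUopen (hKU hKD)
  have hVU₀ : closure V ⊆ U₀ := hVU.trans (hzero.trans interior_subset)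
  refine ⟨{x | ∀ s ≤ T, φ s x ∈ interior U₀}, {x | ∀ s ≤ T, φ s x ∈ closure V}, T, hUopen,
    isClosed_setOf_forall_le isClosed_closure T, hzero.trans hVU, ?_,
    mapsTo_setOf_forall_le interior_subset hKD hK,
    mapsTo_setOf_forall_le hVU₀ (hKV.trans subset_closure) hK, ?_, ?_⟩
  · refine (hAK.trans (hKU hKV)).trans
      (interior_maximal (fun x hx s hs => subset_closure (hx s hs)) (isOpen_setOf_forall_le hV T))
  · exact fun x hx => hKU (hKV.trans subset_closure) (hK x (interior_subset (hzero hx)) T le_rfl)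
  · exact omegaLimit_mono_right _ _ (hzero.trans interior_subset)

lemma isIndexPair_univ [CompactSpace X] : IsIndexPair φ (maxInv φ Set.univ) Set.univ ∅ where
  isCompact_left := isCompact_univ
  isCompact_right := isCompact_empty
  subset := Set.empty_subset _
  eq_maxInv := by simp
  mem_nhdsSet := by simp
  posInvariant := by simp
  exitSet := by simp

lemma isIndexPair_block [CompactSpace X] {L U : Set X} (hL : IsClosed L)
    (hLinv : ∀ t, Set.MapsTo (φ t) L L) (hLU : L ⊆ U) (hAL : A ⊆ interior L)
    (hU : omegaLimit Filter.atTop φ U ⊆ A) (hA : IsInvariantSet φ A) : IsIndexPair φ A L ∅ where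
  isCompact_left := hL.isCompact
  isCompact_right := isCompact_empty
  subset := Set.empty_subset _
  eq_maxInv := by
    rw [Set.sdiff_empty, hL.closure_eq]
    refine (subset_maxInv (hAL.trans interior_subset) hA).antisymm ?_
    exact ((isInvariantSet_maxInv L).subset_omegaLimit ((maxInv_subset L).trans hLU)).trans hU
  mem_nhdsSet := by rwa [Set.sdiff_empty, ← subset_interior_iff_mem_nhdsSet]
  posInvariant := by simp
  exitSet := fun x hx t _ ht => absurd (hLinv t hx) ht

/-- Points of `L` have a nonempty `ω`-limit set inside `A`, so the dual repeller avoids `L`.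
Conversely, an orbit in an invariant subset of `closure Lᶜ` stays in this closed set, so its
`ω`-limit set misses `interior L`, which contains `A`. -/
lemma isIndexPair_dualRepeller [CompactSpace X] {L U : Set X} (hL : IsClosed L)
    (hLinv : ∀ t, Set.MapsTo (φ t) L L) (hLU : L ⊆ U) (hAL : A ⊆ interior L)
    (hU : omegaLimit Filter.atTop φ U ⊆ A) :
    IsIndexPair φ (maxInv φ (dualRepeller φ A)) Set.univ L := by
  have hRL : dualRepeller φ A ⊆ Lᶜ := fun x hx hxL => by
    have hne : (omegaLimit Filter.atTop φ {x}).Nonempty :=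
      nonempty_omegaLimit _ _ _ (Set.singleton_nonempty x)
    obtain ⟨y, hy⟩ := hne
    exact Set.disjoint_left.1 hx hy
      (hU (omegaLimit_mono_right _ _ (Set.singleton_subset_iff.2 (hLU hxL)) hy))
  refine ⟨isCompact_univ, hL.isCompact, Set.subset_univ _, ?_, ?_, fun x hx t _ s _ => hLinv s hx,
    by simp⟩
  · rw [← Set.compl_eq_univ_sdiff]
    refine (subset_maxInv ((maxInv_subset _).trans (hRL.trans subset_closure))
      (isInvariantSet_maxInv _)).antisymm (subset_maxInv ?_ (isInvariantSet_maxInv _))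
    intro x hx
    refine Set.disjoint_left.2 fun y hy hyA => ?_
    have hsub : closure (Set.image2 φ Set.univ {x}) ⊆ closure Lᶜ := by
      refine closure_minimal ?_ isClosed_closure
      rintro _ ⟨t, -, _, rfl, rfl⟩
      refine maxInv_subset (φ := φ) _ ?_
      rw [← isInvariantSet_maxInv (φ := φ) (closure Lᶜ) t]
      exact ⟨_, hx, rfl⟩
    have hy' := hsub (Set.mem_iInter₂.1 hy Set.univ Filter.univ_mem)
    rw [closure_compl] at hy'
    exact hy' (hAL hyA)
  · rw [← Set.compl_eq_univ_sdiff]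
    exact hL.isOpen_compl.mem_nhdsSet.2 ((maxInv_subset _).trans hRL)

end Blocks

/-! ### The long exact sequence of a pair -/

/-- Singular homology with integer coefficients. -/
abbrev singHomology (Y : TopCat.{u}) (i : ℕ) : ModuleCat.{u} ℤ := (singularChains Y).homology i

/-- The map on singular homology induced by a continuous map. -/
abbrev singHomologyMap {Y Z : TopCat.{u}} (f : Y ⟶ Z) (i : ℕ) :
    singHomology Y i ⟶ singHomology Z i :=
  HomologicalComplex.homologyMap (singularChainsMap f) i

lemma singHomologyMap_comp_apply {Y Z W : TopCat.{u}} (f : Y ⟶ Z) (g : Z ⟶ W) (i : ℕ)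
    (x : singHomology Y i) :
    singHomologyMap (f ≫ g) i x = singHomologyMap g i (singHomologyMap f i x) := by
  rw [singHomologyMap, singularChainsMap_comp, HomologicalComplex.homologyMap_comp]
  rfl

lemma singHomologyMap_id_apply (Y : TopCat.{u}) (i : ℕ) (x : singHomology Y i) :
    singHomologyMap (𝟙 Y) i x = x := by
  rw [singHomologyMap, singularChainsMap_id, HomologicalComplex.homologyMap_id]
  rfl

lemma subsingleton_singularChains (Y : TopCat.{u}) [IsEmpty Y] (n : ℕ) :
    Subsingleton ((singularChains Y).X n) :=
  have : IsEmpty C(TopSimplex n, Y) := ⟨fun σ => isEmptyElim (σ (vertices n 0))⟩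
  (chainsEquiv Y n).toEquiv.subsingleton

lemma nonempty_of_singHomology_zero {Y : TopCat.{u}} (h : Nonempty (singHomology Y 0 ≃ₗ[ℤ] ℤ)) :
    Nonempty Y := by
  obtain ⟨e⟩ := h
  by_contra hY
  have := not_nonempty_iff.1 hY
  have := subsingleton_singularChains Y 0
  have : Subsingleton ((singularChains Y).cycles 0) := (iCycles_injective 0).subsingleton
  have : Subsingleton (singHomology Y 0) := (homologyπ_surjective 0).subsingleton
  have : Subsingleton ℤ := e.symm.toEquiv.subsingleton
  exact not_subsingleton ℤ this

lemma nonempty_singHomology_point_equiv :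
    Nonempty (singHomology (TopCat.of PUnit.{u + 1}) 0 ≃ₗ[ℤ] ℤ) :=
  ⟨(asIso ((TopCat.of PUnit.{u + 1}).singularHomology₀ε coeffs.{u})).toLinearEquiv.trans
    ULift.moduleEquiv⟩

lemma bijective_of_surjective_of_equiv_int {M M' : Type*} [AddCommGroup M] [Module ℤ M]
    [AddCommGroup M'] [Module ℤ M'] (e : M ≃ₗ[ℤ] ℤ) (e' : M' ≃ₗ[ℤ] ℤ) (f : M →ₗ[ℤ] M')
    (hf : Function.Surjective f) : Function.Bijective f := by
  refine ⟨?_, hf⟩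
  have h := IsNoetherian.injective_of_surjective_endomorphism
    (e'.toLinearMap ∘ₗ f ∘ₗ e.symm.toLinearMap)
    (e'.surjective.comp (hf.comp e.symm.surjective))
  intro x y hxy
  apply e.injective
  apply h
  simp [hxy]

/-- A map of spaces with infinite cyclic `H_0` is an isomorphism on `H_0`. -/
lemma bijective_singHomologyMap_zero {Y Z : TopCat.{u}} (f : Y ⟶ Z)
    (hY : Nonempty (singHomology Y 0 ≃ₗ[ℤ] ℤ)) (hZ : Nonempty (singHomology Z 0 ≃ₗ[ℤ] ℤ)) :
    Function.Bijective (singHomologyMap f 0) := by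
  -- The map to a point has a section, so it is surjective on $H_0$, and a surjection between
  -- infinite cyclic groups is bijective. Two-out-of-three then handles `f`.
  have hpt : ∀ {W : TopCat.{u}} (p : W ⟶ TopCat.of PUnit.{u + 1}),
      Nonempty (singHomology W 0 ≃ₗ[ℤ] ℤ) → Function.Bijective (singHomologyMap p 0) := by
    intro W p hW
    obtain ⟨w⟩ := nonempty_of_singHomology_zero hW
    obtain ⟨e⟩ := hW
    obtain ⟨e'⟩ := nonempty_singHomology_point_equiv.{u}
    refine bijective_of_surjective_of_equiv_int e e' (singHomologyMap p 0).hom fun x => ?_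
    let s : TopCat.of PUnit.{u + 1} ⟶ W := TopCat.ofHom (ContinuousMap.const _ w)
    refine ⟨singHomologyMap s 0 x, ?_⟩
    refine (singHomologyMap_comp_apply s p 0 x).symm.trans ?_
    exact singHomologyMap_id_apply _ 0 x
  let p : Z ⟶ TopCat.of PUnit.{u + 1} := TopCat.ofHom (ContinuousMap.const _ PUnit.unit)
  have h₁ := hpt p hZ
  have h₂ := hpt (f ≫ p) hY
  have h₃ : (singHomologyMap (f ≫ p) 0 : singHomology Y 0 → _) =
      singHomologyMap p 0 ∘ singHomologyMap f 0 := funext (singHomologyMap_comp_apply f p 0)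
  rw [h₃] at h₂
  exact h₁.of_comp_iff' _ |>.1 h₂

section Pair

variable {Y : Type u} [TopologicalSpace Y] (B : Set Y)

lemma pair_exact₁ {i : ℕ} (x : singHomology (TopCat.of B) i)
    (hx : singHomologyMap (subspaceIncl Y B) i x = 0) :
    ∃ y, (pairShortComplex_shortExact Y B).δ (i + 1) i (by simp) y = x :=
  (ShortComplex.moduleCat_exact_iff _).1
    ((pairShortComplex_shortExact Y B).homology_exact₁ (i + 1) i (by simp)) x hx

lemma pair_δ_comp {i : ℕ} (y : relHomology Y B (i + 1)) :
    singHomologyMap (subspaceIncl Y B) i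
      ((pairShortComplex_shortExact Y B).δ (i + 1) i (by simp) y) = 0 :=
  LinearMap.congr_fun (congrArg ModuleCat.Hom.hom
    ((pairShortComplex_shortExact Y B).δ_comp (i + 1) i (by simp))) y

lemma pair_exact₃ {i : ℕ} (y : relHomology Y B (i + 1))
    (hy : (pairShortComplex_shortExact Y B).δ (i + 1) i (by simp) y = 0) :
    ∃ x : singHomology (TopCat.of Y) (i + 1),
      HomologicalComplex.homologyMap (relProj Y B) (i + 1) x = y :=
  (ShortComplex.moduleCat_exact_iff _).1
    ((pairShortComplex_shortExact Y B).homology_exact₃ (i + 1) i (by simp)) y hy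

lemma pair_comp_zero {i : ℕ} (x : singHomology (TopCat.of B) i) :
    HomologicalComplex.homologyMap (relProj Y B) i
      (singHomologyMap (subspaceIncl Y B) i x) = 0 :=
  LinearMap.congr_fun (congrArg ModuleCat.Hom.hom
    (ShortComplex.mk _ _ (by
      refine (HomologicalComplex.homologyMap_comp (singularChainsMap (subspaceIncl Y B))
        (relProj Y B) i).symm.trans ?_
      exact (congrArg (HomologicalComplex.homologyMap · i) (pairShortComplex Y B).zero).trans
        (HomologicalComplex.homologyMap_zero _ _ i) :
      singHomologyMap (subspaceIncl Y B) i ≫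
        HomologicalComplex.homologyMap (relProj Y B) i = 0)).zero) x

/-- In degree zero every chain is a cycle, so any lift of a relative cycle represents an absolute
class. -/
lemma pair_surjective_zero :
    Function.Surjective (HomologicalComplex.homologyMap (relProj Y B) 0) := by
  intro h
  obtain ⟨z, rfl⟩ := homologyπ_surjective 0 h
  obtain ⟨c, hc⟩ := relProj_surjective B 0 ((relChains Y B).iCycles 0 z)
  obtain ⟨z', hz'⟩ := exists_cycle c (by
    rw [HomologicalComplex.shape _ _ _ (by simp)]; rfl)
  refine ⟨(singularChains (TopCat.of Y)).homologyπ 0 z', ?_⟩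
  refine (LinearMap.congr_fun (congrArg ModuleCat.Hom.hom
    (HomologicalComplex.homologyπ_naturality (relProj Y B) 0)) z').trans
    (congrArg ((relChains Y B).homologyπ 0) (iCycles_injective 0 ?_))
  refine (LinearMap.congr_fun (congrArg ModuleCat.Hom.hom
    (HomologicalComplex.cyclesMap_i (relProj Y B) 0)) z').trans ?_
  refine Eq.trans (congrArg ((relProj Y B).f 0) hz') hc

/-- A space with the homology of a point, relative to a subspace with the homology of a circle, has
the reduced homology of a two-dimensional sphere. -/
lemma relHomology_of_circle_of_point
    (hB : ∀ i, (i ≤ 1 → Nonempty (singHomology (TopCat.of B) i ≃ₗ[ℤ] ℤ)) ∧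
      (1 < i → Subsingleton (singHomology (TopCat.of B) i)))
    (hY : ∀ i, (i = 0 → Nonempty (singHomology (TopCat.of Y) i ≃ₗ[ℤ] ℤ)) ∧
      (0 < i → Subsingleton (singHomology (TopCat.of Y) i))) (i : ℕ) :
    (i = 2 → Nonempty (relHomology Y B i ≃ₗ[ℤ] ℤ)) ∧
      (i ≠ 2 → Subsingleton (relHomology Y B i)) := by
  have hbij := bijective_singHomologyMap_zero (subspaceIncl Y B) ((hB 0).1 zero_le_one)
    ((hY 0).1 rfl)
  -- The kernel of the connecting map is the image of `singHomology (TopCat.of Y) (i + 1)`, which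
  -- vanishes in positive degrees.
  have hδinj : ∀ i, Function.Injective
      ((pairShortComplex_shortExact Y B).δ (i + 1) i (by simp)).hom := fun i => by
    refine (injective_iff_map_eq_zero _).2 fun y hy => ?_
    obtain ⟨x, rfl⟩ := pair_exact₃ B y hy
    have := (hY (i + 1)).2 (Nat.succ_pos i)
    rw [Subsingleton.elim x 0, map_zero]
    rfl
  constructor
  · rintro rfl
    obtain ⟨e⟩ := (hB 1).1 le_rfl
    refine ⟨(LinearEquiv.ofBijective _ ⟨hδinj 1, fun x => ?_⟩).trans e⟩
    have := (hY 1).2 one_pos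
    exact pair_exact₁ B x (Subsingleton.elim _ _)
  · intro hi
    match i with
    | 0 =>
      refine subsingleton_of_forall_eq 0 fun y => ?_
      obtain ⟨x, rfl⟩ := pair_surjective_zero B y
      obtain ⟨b, rfl⟩ := hbij.2 x
      exact pair_comp_zero B b
    | 1 =>
      -- The connecting map lands in the kernel of $H_0(B)\to H_0(Y)$, which is trivial.
      refine subsingleton_of_forall_eq 0 fun y => hδinj 0 ?_
      refine (hbij.1 ?_).trans (map_zero _).symm
      exact (pair_δ_comp B y).trans (map_zero _).symm
    | 2 => exact absurd rfl hi
    | i + 3 =>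
      have : Subsingleton ((pairShortComplex Y B).X₁.homology (i + 2)) := (hB (i + 2)).2 (by omega)
      exact (hδinj (i + 2)).subsingleton

/-- Homology relative to the empty set is absolute homology. -/
lemma nonempty_relHomology_empty_equiv (hB : B = ∅) (i : ℕ) :
    Nonempty (relHomology Y B i ≃ₗ[ℤ] singHomology (TopCat.of Y) i) := by
  have : IsEmpty (TopCat.of B) := by subst hB; exact inferInstanceAs (IsEmpty (∅ : Set Y))
  have h0 : singularChainsMap (subspaceIncl Y B) = 0 := by
    ext n x
    have := subsingleton_singularChains (TopCat.of B) n
    rw [Subsingleton.elim x 0, map_zero, map_zero]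
  exact ⟨(HomologicalComplex.homologyMapIso
    (cokernelIsoOfEq h0 ≪≫ cokernelZeroIsoTarget) i).toLinearEquiv⟩

end Pair

lemma nonempty_singHomology_equiv_of_homeomorph {Y Z : Type u} [TopologicalSpace Y]
    [TopologicalSpace Z] (e : Y ≃ₜ Z) (i : ℕ) :
    Nonempty (singHomology (TopCat.of Y) i ≃ₗ[ℤ] singHomology (TopCat.of Z) i) := by
  let f : TopCat.of Y ⟶ TopCat.of Z := TopCat.ofHom ⟨e, e.continuous⟩
  let g : TopCat.of Z ⟶ TopCat.of Y := TopCat.ofHom ⟨e.symm, e.symm.continuous⟩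
  have := quasiIso_singularChainsMap f g
    (homotopyOfEq (f := f ≫ g) (g := 𝟙 (TopCat.of Y)) fun y => e.symm_apply_apply y)
    (homotopyOfEq (f := g ≫ f) (g := 𝟙 (TopCat.of Z)) fun z => e.apply_symm_apply z)
  exact ⟨(isoOfQuasiIsoAt (singularChainsMap f) i).toLinearEquiv⟩

/-- The Conley index of the dual repeller, for an attractor with the homology of a circle in a space
with the homology of a point. -/
lemma IsAttractor.conleyIndex_dualRepeller {X : Type u} [MetricSpace X] [CompactSpace X]
    (φ : Flow ℝ≥0 X) (A : Set X) (hA : IsAttractor φ A)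
    (NA LA : Set X) (hNA : IsGoodIndexPair φ A NA LA)
    (hCHA : ∀ i : ℕ,
      (i ≤ 1 → Nonempty (pairHomology NA LA i ≃ₗ[ℤ] ℤ)) ∧
      (1 < i → Subsingleton (pairHomology NA LA i)))
    (NX LX : Set X)
    (hNX : IsGoodIndexPair φ (maxInv φ Set.univ) NX LX)
    (hCHX : ∀ i : ℕ,
      (i = 0 → Nonempty (pairHomology NX LX i ≃ₗ[ℤ] ℤ)) ∧
      (0 < i → Subsingleton (pairHomology NX LX i))) :
    (∃ N L : Set X, IsGoodIndexPair φ (maxInv φ (dualRepeller φ A)) N L) ∧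
    ∀ N L : Set X, IsGoodIndexPair φ (maxInv φ (dualRepeller φ A)) N L → ∀ i : ℕ,
      (i = 2 → Nonempty (pairHomology N L i ≃ₗ[ℤ] ℤ)) ∧
      (i ≠ 2 → Subsingleton (pairHomology N L i)) := by
  obtain ⟨U, B, T, hU, hB, hBU, hAB, hUinv, hBinv, hT, hω⟩ := hA.exists_block
  -- Invariance is read off from the given index pair, which exhibits `A` as a maximal invariant
  -- set.
  have hAinv : IsInvariantSet φ A := by
    rw [hNA.eq_maxInv]
    exact isInvariantSet_maxInv _
  -- With an empty exit set, the empty set serves as its open neighbourhood, and `T = 0` suffices.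
  have hgX : IsGoodIndexPair φ (maxInv φ Set.univ) Set.univ ∅ :=
    isIndexPair_univ.isGoodIndexPair isOpen_empty (Set.empty_subset _)
      (fun _ => Set.mapsTo_univ _ _) (fun _ => Set.mapsTo_empty _ _)
      (fun _ => Set.mapsTo_empty _ _) (T := 0) (Set.mapsTo_empty _ _)
  have hgA : IsGoodIndexPair φ A B ∅ :=
    (isIndexPair_block hB hBinv hBU hAB hω hAinv).isGoodIndexPair isOpen_empty
      (Set.empty_subset _) hBinv (fun _ => Set.mapsTo_empty _ _)
      (fun _ => Set.mapsTo_empty _ _) (T := 0) (Set.mapsTo_empty _ _)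
  have hgR : IsGoodIndexPair φ (maxInv φ (dualRepeller φ A)) Set.univ B :=
    (isIndexPair_dualRepeller hB hBinv hBU hAB hω).isGoodIndexPair hU hBU
      (fun _ => Set.mapsTo_univ _ _) hBinv hUinv hT
  refine ⟨⟨_, _, hgR⟩, fun N L hNL i => ?_⟩
  let Y : Set (Set.univ : Set X) := {y | (y : X) ∈ B}
  have eX : ∀ i, Nonempty (pairHomology NX LX i ≃ₗ[ℤ]
      singHomology (TopCat.of (Set.univ : Set X)) i) := fun i => by
    obtain ⟨e₁⟩ := hNX.nonempty_pairHomology_equiv hgX i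
    obtain ⟨e₂⟩ := nonempty_relHomology_empty_equiv
      {y : (Set.univ : Set X) | (y : X) ∈ (∅ : Set X)} rfl i
    exact ⟨e₁.trans e₂⟩
  have eA : ∀ i, Nonempty (pairHomology NA LA i ≃ₗ[ℤ] singHomology (TopCat.of Y) i) := fun i => by
    obtain ⟨e₁⟩ := hNA.nonempty_pairHomology_equiv hgA i
    obtain ⟨e₂⟩ := nonempty_relHomology_empty_equiv {y : B | (y : X) ∈ (∅ : Set X)} rfl i
    let h : B ≃ₜ Y :=
      { toFun := fun y => ⟨⟨y, trivial⟩, y.2⟩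
        invFun := fun y => ⟨y.1.1, y.2⟩
        left_inv := fun _ => rfl
        right_inv := fun _ => rfl
        continuous_toFun := by fun_prop
        continuous_invFun := by fun_prop }
    obtain ⟨e₃⟩ := nonempty_singHomology_equiv_of_homeomorph h i
    exact ⟨(e₁.trans e₂).trans e₃⟩
  have key := relHomology_of_circle_of_point Y
    (fun i => ⟨fun hi => ((hCHA i).1 hi).elim fun e => (eA i).elim fun e' => ⟨e'.symm.trans e⟩,
      fun hi => (eA i).elim fun e =>
        have := (hCHA i).2 hi
        e.symm.toEquiv.subsingleton⟩)
    (fun i => ⟨fun hi => ((hCHX i).1 hi).elim fun e => (eX i).elim fun e' => ⟨e'.symm.trans e⟩,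
      fun hi => (eX i).elim fun e =>
        have := (hCHX i).2 hi
        e.symm.toEquiv.subsingleton⟩) i
  obtain ⟨e⟩ := hNL.nonempty_pairHomology_equiv hgR i
  refine ⟨fun hi => (key.1 hi).elim fun e' => ⟨e.trans e'⟩, fun hi => ?_⟩
  have : Subsingleton (pairHomology Set.univ B i) := key.2 hi
  exact e.toEquiv.subsingleton

end

end ConleyIndex

theorem mainTheorem7 {X : Type*} [MetricSpace X] [CompactSpace X] (φ : Flow ℝ≥0 X)
    (A R : Set X) (hA : ConleyIndex.IsAttractor φ A) (hR : R = ConleyIndex.dualRepeller φ A)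
    (NA LA : Set X) (hNA : ConleyIndex.IsGoodIndexPair φ A NA LA)
    (hCHA : ∀ i : ℕ,
      (i ≤ 1 → Nonempty (ConleyIndex.pairHomology NA LA i ≃ₗ[ℤ] ℤ)) ∧
      (1 < i → Subsingleton (ConleyIndex.pairHomology NA LA i)))
    (NX LX : Set X)
    (hNX : ConleyIndex.IsGoodIndexPair φ (ConleyIndex.maxInv φ Set.univ) NX LX)
    (hCHX : ∀ i : ℕ,
      (i = 0 → Nonempty (ConleyIndex.pairHomology NX LX i ≃ₗ[ℤ] ℤ)) ∧
      (0 < i → Subsingleton (ConleyIndex.pairHomology NX LX i))) :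
    (∃ N L : Set X, ConleyIndex.IsGoodIndexPair φ (ConleyIndex.maxInv φ R) N L) ∧
    ∀ N L : Set X, ConleyIndex.IsGoodIndexPair φ (ConleyIndex.maxInv φ R) N L → ∀ i : ℕ,
      (i = 2 → Nonempty (ConleyIndex.pairHomology N L i ≃ₗ[ℤ] ℤ)) ∧
      (i ≠ 2 → Subsingleton (ConleyIndex.pairHomology N L i)) := by
  subst hR
  exact hA.conleyIndex_dualRepeller φ A NA LA hNA hCHA NX LX hNX hCHX
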